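/- Let $(\hat M,\hat g,\hat\nabla,\hat\nabla^*)$ be a statistical manifold of dimension $4m$: $\hat g$ is a Riemannian metric, $\hat\nabla,\hat\nabla^*$ are torsion-free affine connections with $X\hat g(Y,Z)=\hat g(\hat\nabla_XY,Z)+\hat g(Y,\hat\nabla^*_XZ)$ and $(\hat\nabla_X\hat g)(Y,Z)=(\hat\nabla_Y\hat g)(X,Z)$. Let $\hat M$ be quaternionic Kaehler-like with constant $c\in\mathbb R$. That is, there is a bundle $\Lambda\subset\mathrm{End}(T\hat M)$ with, around each point, a canonical local basis $J_1,J_2,J_3$ ($J_\alpha^2=-I$, $J_\alpha J_{\alpha+1}=-J_{\alpha+1}J_\alpha=J_{\alpha+2}$, indices mod $3$), there are endomorphism fields $J_\alpha^*$ with $\hat g(J_\alpha X,Y)+\hat g(X,J_\alpha^*Y)=0$, and for every canonical local basis there are local $1$-forms $\omega_\alpha$ with $(\hat\nabla_XJ_\alpha)Y=\omega_{\alpha+2}(X)J_{\alpha+1}Y-\omega_{\alpha+1}(X)J_{\alpha+2}Y$, and the curvature $\hat R$ of $\hat\nabla$ satisfies $$\hat R(X,Y)Z=\tfrac c4\Big\{\hat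 g(Y,Z)X-\hat g(X,Z)Y+\sum_{\alpha=1}^3\big[\hat g(Z,J_\alpha Y)J_\alpha X-\hat g(Z,J_\alpha X)J_\alpha Y\big]+\sum_{\alpha=1}^3\big[\hat g(X,J_\alpha Y)J_\alpha Z-\hat g(J_\alpha X,Y)J_\alpha Z\big]\Big\}.$$ Let $M$ be an (immersed) submanifold of $\hat M$ of dimension $n$, with the induced metric $g$ and the connections $\nabla,\nabla^*$ and second fundamental forms $\sigma,\sigma^*$ given by the tangential and normal parts $\hat\nabla_XY=\nabla_XY+\sigma(X,Y)$, $\hat\nabla^*_XY=\nabla^*_XY+\sigma^*(X,Y)$. Suppose $M$ is totally real: $J(T_pM)\perp T_pM$ for all $p\in M$ and $J\in\Lambda$. Let $R,R^*,R^\circ$ be the curvature tensors of $\nabla$, $\nabla^*$ and of the Levi-Civita connection $\nabla^\circ=\frac12(\nabla+\nabla^*)$, and $\hat R^\circ$ that of $\hat\nabla^\circ=\frac12(\hat\nabla+\hat\nabla^*)$. For a plane $\pi\subset T_pM$ with orthonormal basis $X,Y$ put $$K(\pi)=\tfrac12\big[g(R(X,Y)Y,X)+g(R^*(X,Y)Y,X)-2g(R^\circ(X,Y)Y,X)\big],$$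 $$K_\circ(\pi)=g(R^\circ(X,Y)Y,X),\qquad \hat K_\circ(\pi)=\hat g(\hat R^\circ(X,Y)Y,X),$$ and, for an orthonormal frame $e_1,\dots,e_n$ of $T_pM$, let $\tau,\tau_\circ,\hat\tau_\circ$ be the sums over $1\le i<j\le n$ of $K,K_\circ,\hat K_\circ$ on the planes spanned by $e_i,e_j$. If at some point $p\in M$ and for some plane $\pi\subset T_pM$ $$(\tau-\tau_\circ)-(K(\pi)-K_\circ(\pi))<\frac c8(n-2)(n+1)+2\hat K_\circ(\pi)-2\hat\tau_\circ,$$ then $M$ is not minimal, that is, it is not the case that both mean curvature vectors $H=\frac1n\sum_i\sigma(e_i,e_i)$ and $H^*=\frac1n\sum_i\sigma^*(e_i,e_i)$ vanish everywhere on $M$. -/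

import Mathlib

open scoped Manifold ContDiff Bundle

noncomputable section

section Connections

variable {E : Type*} [NormedAddCommGroup E] [NormedSpace ℝ E] [FiniteDimensional ℝ E]
  {M : Type*} [TopologicalSpace M] [ChartedSpace E M] [IsManifold 𝓘(ℝ, E) ∞ M]
  {E' : Type*} [NormedAddCommGroup E'] [NormedSpace ℝ E'] [FiniteDimensional ℝ E']
  {N : Type*} [TopologicalSpace N] [ChartedSpace E' N] [IsManifold 𝓘(ℝ, E') ∞ N]

/-- The curvature `R(X, Y)Z = ∇_X ∇_Y Z - ∇_Y ∇_X Z - ∇_[X, Y] Z` at a point `x`, evaluated on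
vector fields. As in Mathlib, `nabla Z x v` stands for `(∇_v Z)(x)`. -/
def curvatureField
    (nabla : (Π x : M, TangentSpace 𝓘(ℝ, E) x) →
      Π x : M, TangentSpace 𝓘(ℝ, E) x → TangentSpace 𝓘(ℝ, E) x)
    (X Y Z : Π x : M, TangentSpace 𝓘(ℝ, E) x) (x : M) : TangentSpace 𝓘(ℝ, E) x :=
  nabla (fun y => nabla Z y (Y y)) x (X x) - nabla (fun y => nabla Z y (X y)) x (Y x)
    - nabla Z x (VectorField.mlieBracket 𝓘(ℝ, E) X Y x)

/-- The curvature tensor `R(u, v)w` at `x`: the tensorial expression `curvatureField`, evaluated on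
the fields extending `u, v, w` that are constant in the preferred trivialization at `x`. -/
def curvature
    (nabla : (Π x : M, TangentSpace 𝓘(ℝ, E) x) →
      Π x : M, TangentSpace 𝓘(ℝ, E) x → TangentSpace 𝓘(ℝ, E) x)
    (x : M) (u v w : TangentSpace 𝓘(ℝ, E) x) : TangentSpace 𝓘(ℝ, E) x :=
  curvatureField nabla (FiberBundle.extend E u) (FiberBundle.extend E v)
    (FiberBundle.extend E w) x

/-- A connection, as a plain operation `Z ↦ (v ↦ ∇_v Z)`. -/
def CovariantDerivative.op
    (cov : CovariantDerivative 𝓘(ℝ, E) E (TangentSpace 𝓘(ℝ, E) : M → Type _)) :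
    (Π x : M, TangentSpace 𝓘(ℝ, E) x) →
      Π x : M, TangentSpace 𝓘(ℝ, E) x → TangentSpace 𝓘(ℝ, E) x :=
  fun Z x v => cov Z x v

/-- The mean of two connections. -/
def meanOp (nabla nabla' : (Π x : M, TangentSpace 𝓘(ℝ, E) x) →
      Π x : M, TangentSpace 𝓘(ℝ, E) x → TangentSpace 𝓘(ℝ, E) x) :
    (Π x : M, TangentSpace 𝓘(ℝ, E) x) →
      Π x : M, TangentSpace 𝓘(ℝ, E) x → TangentSpace 𝓘(ℝ, E) x :=
  fun Z x v => (1 / 2 : ℝ) • (nabla Z x v + nabla' Z x v)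

/-- The covariant derivative `(∇_v s)(p)` of a vector field `s` along a map `f : M → N`, that is, the
pullback connection `f^*∇`. In the local frame `F_i` of `TN` around `f p` given by the preferred
trivialization, `s = ∑ a_i (F_i ∘ f)` and
`∇_v s = ∑ (d a_i(v) F_i (f p) + a_i(p) ∇_{df(v)} F_i)`. -/
def derivAlong (cov : CovariantDerivative 𝓘(ℝ, E') E' (TangentSpace 𝓘(ℝ, E') : N → Type _))
    (f : M → N) (s : Π q : M, TangentSpace 𝓘(ℝ, E') (f q)) (p : M)
    (v : TangentSpace 𝓘(ℝ, E) p) : TangentSpace 𝓘(ℝ, E') (f p) :=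
  letI e := trivializationAt E' (TangentSpace 𝓘(ℝ, E') : N → Type _) (f p)
  e.symm (f p) (mvfderiv 𝓘(ℝ, E) (fun q => (e ⟨f q, s q⟩).2) p v)
    + cov (FiberBundle.extend E' (s p)) (f p) (mfderiv 𝓘(ℝ, E) 𝓘(ℝ, E') f p v)

/-- The push-forward of a vector field on `M`, as a vector field along `f`. -/
def pushAlong (f : M → N) (Y : Π q : M, TangentSpace 𝓘(ℝ, E) q) (q : M) :
    TangentSpace 𝓘(ℝ, E') (f q) :=
  mfderiv 𝓘(ℝ, E) 𝓘(ℝ, E') f q (Y q)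

end Connections

section Statistical

variable (E : Type*) [NormedAddCommGroup E] [NormedSpace ℝ E] [FiniteDimensional ℝ E]
  (N : Type*) [TopologicalSpace N] [ChartedSpace E N] [IsManifold 𝓘(ℝ, E) ∞ N]

/-- A statistical manifold `(N, g, ∇, ∇*)`: a Riemannian metric and a pair of smooth torsion-free
connections that are dual to each other, with `∇g` totally symmetric. -/
structure StatisticalStructure where
  /-- The Riemannian metric. -/
  metric : Bundle.ContMDiffRiemannianMetric 𝓘(ℝ, E) ∞ E (TangentSpace 𝓘(ℝ, E) : N → Type _)
  /-- The connection `∇`. -/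
  conn : CovariantDerivative 𝓘(ℝ, E) E (TangentSpace 𝓘(ℝ, E) : N → Type _)
  /-- The dual connection `∇*`. -/
  dual : CovariantDerivative 𝓘(ℝ, E) E (TangentSpace 𝓘(ℝ, E) : N → Type _)
  conn_smooth : ∀ U : Set N, IsOpen U → ContMDiffCovariantDerivativeOn E ∞ conn.toFun U
  dual_smooth : ∀ U : Set N, IsOpen U → ContMDiffCovariantDerivativeOn E ∞ dual.toFun U
  conn_torsion : conn.torsion = 0
  dual_torsion : dual.torsion = 0
  /-- `X g(Y, Z) = g(∇_X Y, Z) + g(Y, ∇*_X Z)`. -/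
  compat : ∀ (x : N) (X Y Z : Π y : N, TangentSpace 𝓘(ℝ, E) y),
    MDiffAt (T% Y) x → MDiffAt (T% Z) x →
    mvfderiv 𝓘(ℝ, E) (fun y => metric.inner y (Y y) (Z y)) x (X x)
      = metric.inner x (conn Y x (X x)) (Z x) + metric.inner x (Y x) (dual Z x (X x))
  /-- `(∇_X g)(Y, Z) = (∇_Y g)(X, Z)`. -/
  codazzi : ∀ (x : N) (X Y Z : Π y : N, TangentSpace 𝓘(ℝ, E) y),
    MDiffAt (T% X) x → MDiffAt (T% Y) x → MDiffAt (T% Z) x →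
    mvfderiv 𝓘(ℝ, E) (fun y => metric.inner y (Y y) (Z y)) x (X x)
        - metric.inner x (conn Y x (X x)) (Z x) - metric.inner x (Y x) (conn Z x (X x))
      = mvfderiv 𝓘(ℝ, E) (fun y => metric.inner y (X y) (Z y)) x (Y x)
        - metric.inner x (conn X x (Y x)) (Z x) - metric.inner x (X x) (conn Z x (Y x))

end Statistical

section Quaternionic

variable {E : Type*} [NormedAddCommGroup E] [NormedSpace ℝ E] [FiniteDimensional ℝ E]
  {N : Type*} [TopologicalSpace N] [ChartedSpace E N] [IsManifold 𝓘(ℝ, E) ∞ N]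

/-- A field of endomorphisms of the tangent spaces is smooth on `U`. -/
def SmoothEndOn (J : Π x : N, TangentSpace 𝓘(ℝ, E) x →L[ℝ] TangentSpace 𝓘(ℝ, E) x) (U : Set N) :
    Prop :=
  ContMDiffOn 𝓘(ℝ, E) (𝓘(ℝ, E).prod 𝓘(ℝ, E →L[ℝ] E)) ∞
    (fun x => (⟨x, J x⟩ : Bundle.TotalSpace (E →L[ℝ] E)
      (fun x : N => TangentSpace 𝓘(ℝ, E) x →L[ℝ] TangentSpace 𝓘(ℝ, E) x))) U

/-- A `1`-form is smooth on `U`. -/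
def SmoothOneFormOn (θ : Π x : N, TangentSpace 𝓘(ℝ, E) x →L[ℝ] ℝ) (U : Set N) : Prop :=
  ContMDiffOn 𝓘(ℝ, E) (𝓘(ℝ, E).prod 𝓘(ℝ, E →L[ℝ] ℝ)) ∞
    (fun x => (⟨x, θ x⟩ : Bundle.TotalSpace (E →L[ℝ] ℝ)
      (fun x : N => TangentSpace 𝓘(ℝ, E) x →L[ℝ] Bundle.Trivial N ℝ x))) U

/-- `J 0, J 1, J 2` is a canonical local basis, on the open set `U`, of the bundle `Λ` of
endomorphisms. Indices are taken modulo `3`. -/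
structure IsCanonicalBasis
    (Λ : Π x : N, Submodule ℝ (TangentSpace 𝓘(ℝ, E) x →L[ℝ] TangentSpace 𝓘(ℝ, E) x))
    (U : Set N) (J : Fin 3 → Π x : N, TangentSpace 𝓘(ℝ, E) x →L[ℝ] TangentSpace 𝓘(ℝ, E) x) :
    Prop where
  isOpen : IsOpen U
  smooth : ∀ α, SmoothEndOn (J α) U
  span_eq : ∀ x ∈ U, Λ x = Submodule.span ℝ (Set.range fun α => J α x)
  sq : ∀ x ∈ U, ∀ α v, J α x (J α x v) = -v
  mul_succ : ∀ x ∈ U, ∀ α v, J α x (J (α + 1) x v) = J (α + 2) x v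
  succ_mul : ∀ x ∈ U, ∀ α v, -J (α + 1) x (J α x v) = J (α + 2) x v

/-- `Λ` is an almost quaternionic structure: it has canonical local bases around each point. -/
def IsAlmostQuaternionic
    (Λ : Π x : N, Submodule ℝ (TangentSpace 𝓘(ℝ, E) x →L[ℝ] TangentSpace 𝓘(ℝ, E) x)) : Prop :=
  ∀ x : N, ∃ U J, x ∈ U ∧ IsCanonicalBasis Λ U J

/-- The covariant derivative `(∇_v J)w = ∇_v(J W) - J(∇_v W)`, where `W` extends `w`. -/
def covDerivEnd (cov : CovariantDerivative 𝓘(ℝ, E) E (TangentSpace 𝓘(ℝ, E) : N → Type _))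
    (J : Π x : N, TangentSpace 𝓘(ℝ, E) x →L[ℝ] TangentSpace 𝓘(ℝ, E) x) (x : N)
    (v w : TangentSpace 𝓘(ℝ, E) x) : TangentSpace 𝓘(ℝ, E) x :=
  cov (fun y => J y (FiberBundle.extend E w y)) x v - J x (cov (FiberBundle.extend E w) x v)

/-- A statistical manifold with an almost quaternionic structure `Λ` is quaternionic Kaehler-like,
with curvature constant `c`. The metric is not assumed to be invariant under the `J α`. -/
structure IsQuaternionicKaehlerLike (S : StatisticalStructure E N)
    (Λ : Π x : N, Submodule ℝ (TangentSpace 𝓘(ℝ, E) x →L[ℝ] TangentSpace 𝓘(ℝ, E) x)) (c : ℝ) :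
    Prop where
  almostQuaternionic : IsAlmostQuaternionic Λ
  /-- The fields `J*` with `g(J X, Y) + g(X, J* Y) = 0`. -/
  exists_star : ∀ U J, IsCanonicalBasis Λ U J →
    ∃ Jstar : Fin 3 → Π x : N, TangentSpace 𝓘(ℝ, E) x →L[ℝ] TangentSpace 𝓘(ℝ, E) x,
      (∀ α, SmoothEndOn (Jstar α) U) ∧ ∀ x ∈ U, ∀ α v w,
        S.metric.inner x (J α x v) w + S.metric.inner x v (Jstar α x w) = 0
  /-- `(∇_X J_α)Y = θ_{α+2}(X) J_{α+1}Y - θ_{α+1}(X) J_{α+2}Y`. -/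
  parallel : ∀ U J, IsCanonicalBasis Λ U J →
    ∃ θ : Fin 3 → Π x : N, TangentSpace 𝓘(ℝ, E) x →L[ℝ] ℝ,
      (∀ α, SmoothOneFormOn (θ α) U) ∧ ∀ x ∈ U, ∀ α v w,
        covDerivEnd S.conn (J α) x v w
          = θ (α + 2) x v • J (α + 1) x w - θ (α + 1) x v • J (α + 2) x w
  curvature_eq : ∀ U J, IsCanonicalBasis Λ U J → ∀ x ∈ U, ∀ u v w : TangentSpace 𝓘(ℝ, E) x,
    curvature S.conn.op x u v w = (c / 4) •
      (S.metric.inner x v w • u - S.metric.inner x u w • v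
        + ∑ α, (S.metric.inner x w (J α x v) • J α x u - S.metric.inner x w (J α x u) • J α x v)
        + ∑ α, (S.metric.inner x u (J α x v) • J α x w - S.metric.inner x (J α x u) v • J α x w))

end Quaternionic

section Submanifold

variable {E : Type*} [NormedAddCommGroup E] [NormedSpace ℝ E] [FiniteDimensional ℝ E]
  {M : Type*} [TopologicalSpace M] [ChartedSpace E M] [IsManifold 𝓘(ℝ, E) ∞ M]
  {E' : Type*} [NormedAddCommGroup E'] [NormedSpace ℝ E'] [FiniteDimensional ℝ E']
  {N : Type*} [TopologicalSpace N] [ChartedSpace E' N] [IsManifold 𝓘(ℝ, E') ∞ N]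

/-- `f` makes `M` an (immersed) submanifold of `N`. -/
structure IsSubmanifoldMap (f : M → N) : Prop where
  smooth : ContMDiff 𝓘(ℝ, E) 𝓘(ℝ, E') ∞ f
  injective_mfderiv : ∀ p, Function.Injective (mfderiv 𝓘(ℝ, E) 𝓘(ℝ, E') f p)

/-- The induced metric `g = f^*g`. -/
def inducedMetric (S : StatisticalStructure E' N) (f : M → N) (p : M)
    (v w : TangentSpace 𝓘(ℝ, E) p) : ℝ :=
  S.metric.inner (f p) (mfderiv 𝓘(ℝ, E) 𝓘(ℝ, E') f p v) (mfderiv 𝓘(ℝ, E) 𝓘(ℝ, E') f p w)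

/-- `ξ - df(u)` is normal to `M`. -/
def IsTangentialPart (S : StatisticalStructure E' N) (f : M → N) (p : M)
    (ξ : TangentSpace 𝓘(ℝ, E') (f p)) (u : TangentSpace 𝓘(ℝ, E) p) : Prop :=
  ∀ w : TangentSpace 𝓘(ℝ, E) p, S.metric.inner (f p)
    (ξ - mfderiv 𝓘(ℝ, E) 𝓘(ℝ, E') f p u) (mfderiv 𝓘(ℝ, E) 𝓘(ℝ, E') f p w) = 0

/-- The tangential part of `ξ`, as a vector of `T_p M`. -/
def tangentialPart (S : StatisticalStructure E' N) (f : M → N) (p : M)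
    (ξ : TangentSpace 𝓘(ℝ, E') (f p)) : TangentSpace 𝓘(ℝ, E) p :=
  Classical.epsilon (IsTangentialPart S f p ξ)

theorem existsUnique_tangentialPart (S : StatisticalStructure E' N) {f : M → N}
    (hf : IsSubmanifoldMap (E := E) (E' := E') f) (p : M) (ξ : TangentSpace 𝓘(ℝ, E') (f p)) :
    ∃! u : TangentSpace 𝓘(ℝ, E) p, IsTangentialPart S f p ξ u := by
  let d := mfderiv 𝓘(ℝ, E) 𝓘(ℝ, E') f p
  let φ : TangentSpace 𝓘(ℝ, E) p →ₗ[ℝ] Module.Dual ℝ (TangentSpace 𝓘(ℝ, E) p) :=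
    LinearMap.mk₂ ℝ (fun u w => S.metric.inner (f p) (d u) (d w))
      (by intros; simp) (by intros; simp) (by intros; simp) (by intros; simp)
  have hφ (u w) : φ u w = S.metric.inner (f p) (d u) (d w) := rfl
  have hinj : Function.Injective φ := by
    rw [injective_iff_map_eq_zero]
    intro u hu
    by_contra hne
    have hd : d u ≠ 0 := fun h0 => hne (hf.injective_mfderiv p (h0.trans (map_zero d).symm))
    have := S.metric.pos (f p) (d u) hd
    rw [← hφ, hu] at this
    simp at this
  have : FiniteDimensional ℝ (TangentSpace 𝓘(ℝ, E) p) := inferInstanceAs (FiniteDimensional ℝ E)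
  have hsurj : Function.Surjective φ :=
    (LinearMap.injective_iff_surjective_of_finrank_eq_finrank
      (Subspace.dual_finrank_eq (K := ℝ) (V := TangentSpace 𝓘(ℝ, E) p)).symm).1 hinj
  have key (u) : IsTangentialPart S f p ξ u ↔
      φ u = ((S.metric.inner (f p) ξ).comp d).toLinearMap := by
    rw [LinearMap.ext_iff]
    refine forall_congr' fun w => ?_
    rw [map_sub, sub_apply, sub_eq_zero, eq_comm]
    rfl
  obtain ⟨u, hu⟩ := hsurj ((S.metric.inner (f p) ξ).comp d).toLinearMap
  exact ⟨u, (key u).2 hu, fun y hy => hinj (((key y).1 hy).trans hu.symm)⟩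

theorem tangentialPart_spec (S : StatisticalStructure E' N) {f : M → N}
    (hf : IsSubmanifoldMap (E := E) (E' := E') f) (p : M) (ξ : TangentSpace 𝓘(ℝ, E') (f p)) :
    IsTangentialPart S f p ξ (tangentialPart (E := E) S f p ξ) :=
  Classical.epsilon_spec (existsUnique_tangentialPart S hf p ξ).exists

/-- The connection induced on `M` by `cov`: the tangential part in the Gauss formula. -/
def inducedOp (S : StatisticalStructure E' N)
    (cov : CovariantDerivative 𝓘(ℝ, E') E' (TangentSpace 𝓘(ℝ, E') : N → Type _)) (f : M → N) :
    (Π p : M, TangentSpace 𝓘(ℝ, E) p) →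
      Π p : M, TangentSpace 𝓘(ℝ, E) p → TangentSpace 𝓘(ℝ, E) p :=
  fun Y p v => tangentialPart S f p (derivAlong cov f (pushAlong f Y) p v)

/-- The second fundamental form of `M` for `cov`: the normal part in the Gauss formula, where `w` is
extended to a vector field on `M`. -/
def secondForm (S : StatisticalStructure E' N)
    (cov : CovariantDerivative 𝓘(ℝ, E') E' (TangentSpace 𝓘(ℝ, E') : N → Type _)) (f : M → N)
    (p : M) (v w : TangentSpace 𝓘(ℝ, E) p) : TangentSpace 𝓘(ℝ, E') (f p) :=
  derivAlong cov f (pushAlong f (FiberBundle.extend E w)) p v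
    - mfderiv 𝓘(ℝ, E) 𝓘(ℝ, E') f p (inducedOp S cov f (FiberBundle.extend E w) p v)

/-- `e` is an orthonormal frame of `T_p M`. -/
def IsOrthonormalFrame (S : StatisticalStructure E' N) (f : M → N) (p : M) {n : ℕ}
    (e : Fin n → TangentSpace 𝓘(ℝ, E) p) : Prop :=
  Submodule.span ℝ (Set.range e) = ⊤ ∧
    ∀ i j, inducedMetric S f p (e i) (e j) = if i = j then 1 else 0

/-- The mean curvature vector `(1/n) ∑ σ(e_i, e_i)`, for an orthonormal frame `e`. -/
def meanCurvature (S : StatisticalStructure E' N)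
    (cov : CovariantDerivative 𝓘(ℝ, E') E' (TangentSpace 𝓘(ℝ, E') : N → Type _)) (f : M → N)
    (p : M) {n : ℕ} (e : Fin n → TangentSpace 𝓘(ℝ, E) p) : TangentSpace 𝓘(ℝ, E') (f p) :=
  (1 / n : ℝ) • ∑ i, secondForm S cov f p (e i) (e i)

/-- `M` is minimal: `H = H* = 0` everywhere. -/
def IsMinimal (S : StatisticalStructure E' N) (f : M → N) : Prop :=
  ∀ (p : M) (n : ℕ) (e : Fin n → TangentSpace 𝓘(ℝ, E) p),
    IsOrthonormalFrame S f p e →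
      meanCurvature S S.conn f p e = 0 ∧ meanCurvature S S.dual f p e = 0

/-- `M` is totally real: the endomorphisms in `Λ` map tangent spaces of `M` to normal spaces. -/
def IsTotallyReal (S : StatisticalStructure E' N)
    (Λ : Π x : N, Submodule ℝ (TangentSpace 𝓘(ℝ, E') x →L[ℝ] TangentSpace 𝓘(ℝ, E') x))
    (f : M → N) : Prop :=
  ∀ p : M, ∀ J ∈ Λ (f p), ∀ v w : TangentSpace 𝓘(ℝ, E) p,
    S.metric.inner (f p) (J (mfderiv 𝓘(ℝ, E) 𝓘(ℝ, E') f p v)) (mfderiv 𝓘(ℝ, E) 𝓘(ℝ, E') f p w) = 0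

/-- `K_∘(π) = g(R∘(X, Y)Y, X)` on `M`, for `π` with orthonormal basis `X, Y`, where `R∘` is the
curvature of the Levi-Civita connection `∇∘ = (∇ + ∇*)/2` of `M`. -/
def sectionalLC (S : StatisticalStructure E' N) (f : M → N) (p : M)
    (X Y : TangentSpace 𝓘(ℝ, E) p) : ℝ :=
  inducedMetric S f p
    (curvature (meanOp (inducedOp S S.conn f) (inducedOp S S.dual f)) p X Y Y) X

/-- The sectional `K`-curvature of `M`,
`K(π) = (g(R(X, Y)Y, X) + g(R*(X, Y)Y, X) - 2 g(R∘(X, Y)Y, X)) / 2`, for `π` with orthonormal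
basis `X, Y`. -/
def sectionalK (S : StatisticalStructure E' N) (f : M → N) (p : M)
    (X Y : TangentSpace 𝓘(ℝ, E) p) : ℝ :=
  (1 / 2) * (inducedMetric S f p (curvature (inducedOp S S.conn f) p X Y Y) X
    + inducedMetric S f p (curvature (inducedOp S S.dual f) p X Y Y) X
    - 2 * sectionalLC S f p X Y)

/-- `K̂_∘(π)`: the sectional curvature of the Levi-Civita connection `(∇̂ + ∇̂*)/2` of the ambient
manifold, on the image of the plane with orthonormal basis `X, Y`. -/
def sectionalAmbientLC (S : StatisticalStructure E' N) (f : M → N) (p : M)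
    (X Y : TangentSpace 𝓘(ℝ, E) p) : ℝ :=
  S.metric.inner (f p)
    (curvature (meanOp S.conn.op S.dual.op) (f p) (mfderiv 𝓘(ℝ, E) 𝓘(ℝ, E') f p X)
      (mfderiv 𝓘(ℝ, E) 𝓘(ℝ, E') f p Y) (mfderiv 𝓘(ℝ, E) 𝓘(ℝ, E') f p Y))
    (mfderiv 𝓘(ℝ, E) 𝓘(ℝ, E') f p X)

/-- The scalar curvature `∑_{i < j} k(e_i, e_j)` of a sectional curvature `k`, for an orthonormal
frame `e`. -/
def scalarOf {V : Type*} (k : V → V → ℝ) {n : ℕ} (e : Fin n → V) : ℝ :=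
  ∑ i, ∑ j ∈ Finset.univ.filter (fun j => i < j), k (e i) (e j)

end Submanifold

end

/-! Minimality is used only at the point p, and the contradiction comes from an exact formula for K
- K∘ on an orthonormal pair X, Y. The Gauss equation for a dual pair reads g(R(X,Y)Y,X) =
ĝ(R̂(X,Y)Y,X) + ĝ(σ(Y,Y),σ*(X,X)) - ĝ(σ(X,Y),σ*(X,Y)). It is applied to (∇̂,∇̂*), to (∇̂*,∇̂) and to
the self-dual pair (∇̂∘,∇̂∘), whose second fundamental form is (σ+σ*)/2. In K - K∘, which contains
R∘ with coefficient -2, the mixed products of σ and σ* cancel. On a totally real plane the R̂ and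
R̂* terms contribute c/4, because R̂* is determined by R̂ through duality and every J-term has a
vanishing coefficient. What remains (`sectionalK_sub_sectionalLC`,
`inner_curvature_of_isTotallyReal`) is K - K∘ = c/4 - 2K̂∘ - ½[ĝ(σ(X,X),σ(Y,Y)) +
ĝ(σ*(X,X),σ*(Y,Y))] + ½[|σ(X,Y)|² + |σ*(X,Y)|²].

Sum this over all pairs of frame vectors except the one spanning π. The constants give c/8
(n-2)(n+1), and the squares are nonnegative. If Σ σ(e_k,e_k) = 0, expanding the square of this sum
gives Σ_{k<l} ĝ(σ_kk,σ_ll) = -½ Σ |σ_kk|² ≤ -½(|σ_ii|² + |σ_jj|²) ≤ ĝ(σ_ii,σ_jj), so the products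
over the remaining pairs sum to at most 0 (`scalarOf_le_of_sum_eq_zero`); the same holds for σ*.
This is the inequality opposite to the assumed one.

Most of the work is `gauss_equation` for the given definitions, in which fields are extended with
constant coordinates and tangential parts are chosen pointwise. It is proved in charts:
`chart_gauss` differentiates the condition that the second fundamental form is normal, and the later
sections translate connection, metric and induced connection into coordinates. -/

noncomputable section

/-! ### Connections along a map and the Gauss equation in a vector space. -/

section ChartCalculus

set_option synthInstance.maxHeartbeats 200000

open Filter Topology

variable {E : Type*} [NormedAddCommGroup E] [NormedSpace ℝ E]
  {E' : Type*} [NormedAddCommGroup E'] [NormedSpace ℝ E']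

/-- The covariant derivative of a section `s` along a map `F`, in coordinates with Christoffel
symbols `Γ`. -/
def chartDeriv (Γ : E → E' →L[ℝ] E' →L[ℝ] E') (F : E → E') (s : E → E') (v x : E) : E' :=
  fderiv ℝ s x v + Γ x (s x) (fderiv ℝ F x v)

/-- The pull-back by `F` of the curvature tensor, in coordinates with Christoffel symbols `Γ`. -/
def chartCurv (Γ : E → E' →L[ℝ] E' →L[ℝ] E') (F : E → E') (x u v : E) (a : E') : E' :=
  fderiv ℝ Γ x u a (fderiv ℝ F x v) - fderiv ℝ Γ x v a (fderiv ℝ F x u)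
    + Γ x (Γ x a (fderiv ℝ F x v)) (fderiv ℝ F x u)
    - Γ x (Γ x a (fderiv ℝ F x u)) (fderiv ℝ F x v)

variable {Γ Γs : E → E' →L[ℝ] E' →L[ℝ] E'} {F : E → E'} {G : E → E' →L[ℝ] E' →L[ℝ] ℝ} {x : E}

lemma ContDiffAt.differentiableAt_fderiv {f : E → E'} {n : WithTop ℕ∞} (hf : ContDiffAt ℝ n f x)
    (hn : 2 ≤ n) : DifferentiableAt ℝ (fderiv ℝ f) x :=
  (hf.fderiv_right (m := 1) (by rwa [one_add_one_eq_two])).differentiableAt (by simp)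

lemma ContDiffAt.fderiv_fderiv_comm {f : E → E'} {n : WithTop ℕ∞} (hf : ContDiffAt ℝ n f x)
    (hn : 2 ≤ n) (u v : E) :
    fderiv ℝ (fderiv ℝ f) x u v = fderiv ℝ (fderiv ℝ f) x v u :=
  (hf.isSymmSndFDerivAt (by simpa using hn)).eq u v

lemma differentiableAt_chartDeriv (hΓ : DifferentiableAt ℝ Γ x) (hF : ContDiffAt ℝ 2 F x)
    {s : E → E'} (hs : ContDiffAt ℝ 2 s x) (v : E) :
    DifferentiableAt ℝ (chartDeriv Γ F s v) x := by
  have h1 := hs.differentiableAt_fderiv le_rfl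
  have h2 := hF.differentiableAt_fderiv le_rfl
  have h3 := hs.differentiableAt (by simp)
  exact (h1.clm_apply (differentiableAt_const v)).add
    ((hΓ.clm_apply h3).clm_apply (h2.clm_apply (differentiableAt_const v)))

lemma fderiv_chartDeriv (hΓ : DifferentiableAt ℝ Γ x) (hF : ContDiffAt ℝ 2 F x)
    {s : E → E'} (hs : ContDiffAt ℝ 2 s x) (u v : E) :
    fderiv ℝ (chartDeriv Γ F s v) x u = fderiv ℝ (fderiv ℝ s) x u v
      + (fderiv ℝ Γ x u (s x) (fderiv ℝ F x v) + Γ x (fderiv ℝ s x u) (fderiv ℝ F x v)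
        + Γ x (s x) (fderiv ℝ (fderiv ℝ F) x u v)) := by
  have h1 := (hs.differentiableAt_fderiv le_rfl).hasFDerivAt
  have h2 := (hF.differentiableAt_fderiv le_rfl).hasFDerivAt
  have h3 := (hs.differentiableAt (by simp)).hasFDerivAt
  have h := (h1.clm_apply (hasFDerivAt_const v x)).add
    ((hΓ.hasFDerivAt.clm_apply h3).clm_apply (h2.clm_apply (hasFDerivAt_const v x)))
  have h' : fderiv ℝ (chartDeriv Γ F s v) x = _ := h.fderiv
  rw [h']
  simp
  abel

/-- The curvature is the commutator of covariant derivatives in coordinate directions. -/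
lemma chartDeriv_comm (hΓ : DifferentiableAt ℝ Γ x) (hF : ContDiffAt ℝ 2 F x)
    {s : E → E'} (hs : ContDiffAt ℝ 2 s x) (u v : E) :
    chartDeriv Γ F (chartDeriv Γ F s v) u x - chartDeriv Γ F (chartDeriv Γ F s u) v x
      = chartCurv Γ F x u v (s x) := by
  have e1 := hs.fderiv_fderiv_comm le_rfl u v
  have e2 := hF.fderiv_fderiv_comm le_rfl u v
  have e3 (t : E → E') (w : E) :
      chartDeriv Γ F t w x = fderiv ℝ t x w + Γ x (t x) (fderiv ℝ F x w) := rfl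
  rw [e3 (chartDeriv Γ F s v), e3 (chartDeriv Γ F s u), fderiv_chartDeriv hΓ hF hs u v,
    fderiv_chartDeriv hΓ hF hs v u, e1, e2]
  simp only [chartDeriv, chartCurv, map_add, add_apply]
  abel

/-- Duality is assumed only on constant coefficient vectors; the terms of the product rule in which
`s` and `t` are differentiated complete the Christoffel terms to covariant derivatives. -/
lemma fderiv_metric_apply (hG : DifferentiableAt ℝ G x)
    (hc : ∀ u a b, fderiv ℝ G x u a b
      = G x (Γ x a (fderiv ℝ F x u)) b + G x a (Γs x b (fderiv ℝ F x u)))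
    {s t : E → E'} (hs : DifferentiableAt ℝ s x) (ht : DifferentiableAt ℝ t x) (u : E) :
    fderiv ℝ (fun y => G y (s y) (t y)) x u
      = G x (chartDeriv Γ F s u x) (t x) + G x (s x) (chartDeriv Γs F t u x) := by
  have h := (hG.hasFDerivAt.clm_apply hs.hasFDerivAt).clm_apply ht.hasFDerivAt
  rw [h.fderiv]
  simp [hc, chartDeriv]
  abel

/-- The curvature tensors of dual connections are dual to each other. -/
lemma chartCurv_dual (hΓ : DifferentiableAt ℝ Γ x) (hΓs : DifferentiableAt ℝ Γs x)
    (hF : ContDiffAt ℝ 2 F x) (hG : ContDiffAt ℝ 2 G x)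
    (hc : ∀ᶠ y in 𝓝 x, ∀ u a b, fderiv ℝ G y u a b
      = G y (Γ y a (fderiv ℝ F y u)) b + G y a (Γs y b (fderiv ℝ F y u)))
    (u v : E) (a b : E') :
    G x (chartCurv Γ F x u v a) b + G x a (chartCurv Γs F x u v b) = 0 := by
  have ha : ContDiffAt ℝ 2 (fun _ : E => a) x := contDiffAt_const
  have hb : ContDiffAt ℝ 2 (fun _ : E => b) x := contDiffAt_const
  have hG1 : DifferentiableAt ℝ G x := hG.differentiableAt (by simp)
  have hGe : ∀ᶠ y in 𝓝 x, DifferentiableAt ℝ G y :=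
    (hG.eventually (by simp)).mono fun y hy => hy.differentiableAt (by simp)
  -- Applying duality twice expands the second derivative of G(a, b). The two products of first
  -- derivatives are exchanged by u ↔ v.
  have key (u v : E) : fderiv ℝ (fderiv ℝ fun y => G y a b) x u v
      = G x (chartDeriv Γ F (chartDeriv Γ F (fun _ => a) v) u x) b
        + G x (chartDeriv Γ F (fun _ => a) v x) (chartDeriv Γs F (fun _ => b) u x)
        + (G x (chartDeriv Γ F (fun _ => a) u x) (chartDeriv Γs F (fun _ => b) v x)
        + G x a (chartDeriv Γs F (chartDeriv Γs F (fun _ => b) v) u x)) := by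
    have hd : DifferentiableAt ℝ (fderiv ℝ fun y => G y a b) x :=
      ContDiffAt.differentiableAt_fderiv (n := 2)
        ((hG.clm_apply contDiffAt_const).clm_apply contDiffAt_const) le_rfl
    have e1 : fderiv ℝ (fderiv ℝ fun y => G y a b) x u v
        = fderiv ℝ (fun z => fderiv ℝ (fun y => G y a b) z v) x u := by
      rw [(hd.hasFDerivAt.clm_apply (hasFDerivAt_const v x)).fderiv]
      simp
    have e2 : (fun z => fderiv ℝ (fun y => G y a b) z v) =ᶠ[𝓝 x]
        fun z => G z (chartDeriv Γ F (fun _ => a) v z) b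
          + G z a (chartDeriv Γs F (fun _ => b) v z) := by
      filter_upwards [hc, hGe] with z hz hGz
      exact fderiv_metric_apply hGz hz (differentiableAt_const a) (differentiableAt_const b) v
    have d1 := differentiableAt_chartDeriv hΓ hF ha v
    have d2 := differentiableAt_chartDeriv hΓs hF hb v
    rw [e1, e2.fderiv_eq, fderiv_fun_add ((hG1.clm_apply d1).clm_apply (differentiableAt_const b))
        ((hG1.clm_apply (differentiableAt_const a)).clm_apply d2), add_apply,
      fderiv_metric_apply hG1 hc.self_of_nhds d1 (differentiableAt_const b),
      fderiv_metric_apply hG1 hc.self_of_nhds (differentiableAt_const a) d2]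
  have hsymm := ContDiffAt.fderiv_fderiv_comm (n := 2)
    ((hG.clm_apply (contDiffAt_const (c := a))).clm_apply (contDiffAt_const (c := b))) le_rfl u v
  -- Symmetry of the second derivative removes the mixed products and leaves the two commutators,
  -- that is, the curvatures.
  rw [key, key] at hsymm
  rw [← chartDeriv_comm hΓ hF ha u v, ← chartDeriv_comm hΓs hF hb u v]
  simp only [map_sub, sub_apply]
  linarith

/-- A field satisfying the normal equations of the tangential projection is differentiable. -/
lemma differentiableAt_of_normal_equations [FiniteDimensional ℝ E]
    (hF : ContDiffAt ℝ 2 F x) (hG : DifferentiableAt ℝ G x)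
    (hpos : ∀ a : E', a ≠ 0 → 0 < G x a a) (hinj : Function.Injective (fderiv ℝ F x))
    {ξ : E → E'} (hξ : DifferentiableAt ℝ ξ x) {Z : E → E}
    (hZ : ∀ᶠ y in 𝓝 x, ∀ w, G y (ξ y - fderiv ℝ F y (Z y)) (fderiv ℝ F y w) = 0) :
    DifferentiableAt ℝ Z x := by
  have hF1 := hF.differentiableAt_fderiv le_rfl
  -- The Gram form of the induced metric. It is injective by positivity, hence invertible in finite
  -- dimension.
  let g : E → E →L[ℝ] E →L[ℝ] ℝ := fun y =>
    ((ContinuousLinearMap.compL ℝ E E' ℝ).flip (fderiv ℝ F y)) ∘L (G y ∘L fderiv ℝ F y)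
  have hg (y v w) : g y v w = G y (fderiv ℝ F y v) (fderiv ℝ F y w) := rfl
  have hgd : DifferentiableAt ℝ g x := by
    simp only [g]
    fun_prop
  have hgi : Function.Injective (g x) := by
    rw [injective_iff_map_eq_zero]
    intro v hv
    by_contra hne
    have := hpos (fderiv ℝ F x v) fun h0 => hne (hinj (h0.trans (map_zero _).symm))
    rw [← hg, hv] at this
    simp at this
  have : FiniteDimensional ℝ (E →L[ℝ] ℝ) := inferInstance
  have hfr : Module.finrank ℝ E = Module.finrank ℝ (E →L[ℝ] ℝ) := by
    rw [← (LinearMap.toContinuousLinearMap (𝕜 := ℝ) (E := E) (F' := ℝ)).finrank_eq]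
    exact (Subspace.dual_finrank_eq (K := ℝ) (V := E)).symm
  let e : E ≃L[ℝ] (E →L[ℝ] ℝ) :=
    (LinearEquiv.ofInjectiveOfFinrankEq (g x).toLinearMap hgi hfr).toContinuousLinearEquiv
  have he : (e : E →L[ℝ] E →L[ℝ] ℝ) = g x := by ext; rfl
  have hcomplete : CompleteSpace E := FiniteDimensional.complete ℝ E
  have hinv : DifferentiableAt ℝ (ContinuousLinearMap.inverse :
      (E →L[ℝ] (E →L[ℝ] ℝ)) → ((E →L[ℝ] ℝ) →L[ℝ] E)) (g x) := by
    rw [← he]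
    exact (contDiffAt_map_inverse (n := 1) e).differentiableAt (by simp)
  have hgu : ∀ᶠ y in 𝓝 x, (g y).IsInvertible := by
    have := hgd.continuousAt.preimage_mem_nhds
      (show Set.range ((↑) : (E ≃L[ℝ] (E →L[ℝ] ℝ)) → E →L[ℝ] (E →L[ℝ] ℝ)) ∈ 𝓝 (g x) by
        rw [← he]; exact ContinuousLinearEquiv.nhds e)
    exact this
  -- The normal equations say g(Z) = G(ξ, dF ·). Solving for Z expresses it through differentiable
  -- data, since inversion is differentiable at an invertible operator.
  have hform : Z =ᶠ[𝓝 x] fun y =>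
      (g y).inverse ((ContinuousLinearMap.compL ℝ E E' ℝ).flip (fderiv ℝ F y) (G y (ξ y))) := by
    filter_upwards [hZ, hgu] with y hy hu
    have : (ContinuousLinearMap.compL ℝ E E' ℝ).flip (fderiv ℝ F y) (G y (ξ y)) = g y (Z y) := by
      ext w
      have := hy w
      simp only [map_sub, sub_apply, sub_eq_zero] at this
      exact this
    rw [this]
    obtain ⟨e', he'⟩ := hu
    rw [← he']
    simp
  rw [hform.differentiableAt_iff]
  have hd1 : DifferentiableAt ℝ (fun y => (g y).inverse) x := 
    DifferentiableAt.comp (𝕜 := ℝ) (E := E) (F := E →L[ℝ] (E →L[ℝ] ℝ)) (G := (E →L[ℝ] ℝ) →L[ℝ] E)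
      (g := ContinuousLinearMap.inverse) (f := g) x hinv hgd
  have hd2 : DifferentiableAt ℝ
      (fun y => (ContinuousLinearMap.compL ℝ E E' ℝ).flip (fderiv ℝ F y)) x :=
    DifferentiableAt.comp (𝕜 := ℝ) (E := E) (F := E →L[ℝ] E')
      (G := (E' →L[ℝ] ℝ) →L[ℝ] (E →L[ℝ] ℝ)) (g := (ContinuousLinearMap.compL ℝ E E' ℝ).flip)
      (f := fderiv ℝ F) x (ContinuousLinearMap.differentiableAt _) hF1
  exact hd1.clm_apply (hd2.clm_apply (hG.clm_apply hξ))

set_option maxHeartbeats 1000000 in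
/-- The Gauss equation in coordinates. -/
lemma chart_gauss [FiniteDimensional ℝ E]
    (hΓ : DifferentiableAt ℝ Γ x)
    (hF : ContDiffAt ℝ 3 F x) (hG : ContDiffAt ℝ 2 G x)
    (hpos : ∀ a : E', a ≠ 0 → 0 < G x a a)
    (hinj : Function.Injective (fderiv ℝ F x))
    (hc : ∀ᶠ y in 𝓝 x, ∀ u a b, fderiv ℝ G y u a b
      = G y (Γ y a (fderiv ℝ F y u)) b + G y a (Γs y b (fderiv ℝ F y u)))
    {u v w d : E} {Zu Zv : E → E} {Wuv Wvu Yu Yv : E}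
    (hZu : ∀ᶠ y in 𝓝 x, ∀ z, G y (chartDeriv Γ F (fun y' => fderiv ℝ F y' w) u y
      - fderiv ℝ F y (Zu y)) (fderiv ℝ F y z) = 0)
    (hZv : ∀ᶠ y in 𝓝 x, ∀ z, G y (chartDeriv Γ F (fun y' => fderiv ℝ F y' w) v y
      - fderiv ℝ F y (Zv y)) (fderiv ℝ F y z) = 0)
    (hWuv : ∀ z, G x (chartDeriv Γ F (fun y' => fderiv ℝ F y' (Zv y')) u x
      - fderiv ℝ F x Wuv) (fderiv ℝ F x z) = 0)
    (hWvu : ∀ z, G x (chartDeriv Γ F (fun y' => fderiv ℝ F y' (Zu y')) v x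
      - fderiv ℝ F x Wvu) (fderiv ℝ F x z) = 0) :
    G x (fderiv ℝ F x (Wuv - Wvu)) (fderiv ℝ F x d)
      = G x (chartCurv Γ F x u v (fderiv ℝ F x w)) (fderiv ℝ F x d)
        + G x (chartDeriv Γ F (fun y' => fderiv ℝ F y' w) v x - fderiv ℝ F x (Zv x))
            (chartDeriv Γs F (fun y' => fderiv ℝ F y' d) u x - fderiv ℝ F x Yu)
        - G x (chartDeriv Γ F (fun y' => fderiv ℝ F y' w) u x - fderiv ℝ F x (Zu x))
            (chartDeriv Γs F (fun y' => fderiv ℝ F y' d) v x - fderiv ℝ F x Yv) := by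
  have hF2 : ContDiffAt ℝ 2 F x := hF.of_le (by norm_num)
  have hF1 := hF2.differentiableAt_fderiv le_rfl
  have hG1 : DifferentiableAt ℝ G x := hG.differentiableAt (by simp)
  have hs (w : E) : ContDiffAt ℝ 2 (fun y' => fderiv ℝ F y' w) x :=
    (hF.fderiv_right (m := 2) (by norm_num)).clm_apply contDiffAt_const
  -- One half of the commutator: differentiate G(∇_v ∂_w F - dF Z, ∂_d F) = 0 in direction u.
  -- Duality moves the derivative of the second slot to ∇*, which is how σ* enters.
  have main {u v : E} {Z : E → E} {W Y : E}
      (hZ : ∀ᶠ y in 𝓝 x, ∀ z, G y (chartDeriv Γ F (fun y' => fderiv ℝ F y' w) v y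
        - fderiv ℝ F y (Z y)) (fderiv ℝ F y z) = 0)
      (hW : ∀ z, G x (chartDeriv Γ F (fun y' => fderiv ℝ F y' (Z y')) u x
        - fderiv ℝ F x W) (fderiv ℝ F x z) = 0) :
      G x (fderiv ℝ F x W) (fderiv ℝ F x d)
        = G x (chartDeriv Γ F (chartDeriv Γ F (fun y' => fderiv ℝ F y' w) v) u x) (fderiv ℝ F x d)
          + G x (chartDeriv Γ F (fun y' => fderiv ℝ F y' w) v x - fderiv ℝ F x (Z x))
            (chartDeriv Γs F (fun y' => fderiv ℝ F y' d) u x - fderiv ℝ F x Y) := by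
    have dD := differentiableAt_chartDeriv hΓ hF2 (hs w) v
    have dZ : DifferentiableAt ℝ Z x :=
      differentiableAt_of_normal_equations hF2 hG1 hpos hinj dD hZ
    have dFZ : DifferentiableAt ℝ (fun y' => fderiv ℝ F y' (Z y')) x := by fun_prop
    have h0 : fderiv ℝ (fun y => G y (chartDeriv Γ F (fun y' => fderiv ℝ F y' w) v y
        - fderiv ℝ F y (Z y)) (fderiv ℝ F y d)) x u = 0 := by
      have : (fun y => G y (chartDeriv Γ F (fun y' => fderiv ℝ F y' w) v y
        - fderiv ℝ F y (Z y)) (fderiv ℝ F y d)) =ᶠ[𝓝 x] fun _ => 0 := hZ.mono fun y hy => hy d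
      rw [this.fderiv_eq]
      simp
    rw [fderiv_metric_apply hG1 hc.self_of_nhds (dD.fun_sub dFZ)
      ((hs d).differentiableAt (by simp))] at h0
    have hsub : chartDeriv Γ F (fun y => chartDeriv Γ F (fun y' => fderiv ℝ F y' w) v y
        - fderiv ℝ F y (Z y)) u x
        = chartDeriv Γ F (chartDeriv Γ F (fun y' => fderiv ℝ F y' w) v) u x
          - chartDeriv Γ F (fun y' => fderiv ℝ F y' (Z y')) u x := by
      have e3 (t : E → E') :
        chartDeriv Γ F t u x = fderiv ℝ t x u + Γ x (t x) (fderiv ℝ F x u) := rfl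
      rw [e3, e3, e3, (dD.hasFDerivAt.fun_sub dFZ.hasFDerivAt).fderiv]
      simp only [map_sub, sub_apply]
      abel
    rw [hsub] at h0
    -- The first factor is normal, so any tangent vector dF(Y) may be subtracted in the second slot;
    -- Y is left free here.
    have hn := hZ.self_of_nhds Y
    have hW' := hW d
    simp only [map_sub, sub_apply] at *
    linarith
  have h1 := main (Y := Yu) hZv hWuv
  have h2 := main (Y := Yv) hZu hWvu
  rw [← chartDeriv_comm hΓ hF2 (hs w) u v]
  simp only [map_sub, sub_apply] at *
  linarith

end ChartCalculus

/-! ### Tangent vectors and derivatives in the preferred charts. -/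

section TangentCoordinates

open Filter Topology

variable {E : Type*} [NormedAddCommGroup E] [NormedSpace ℝ E]
  {M : Type*} [TopologicalSpace M] [ChartedSpace E M] [IsManifold 𝓘(ℝ, E) ∞ M]
  {V : Type*} [NormedAddCommGroup V] [NormedSpace ℝ V]

/-- The coordinates of the tangent vectors at `q` in the preferred trivialization at `p`. -/
def toChart (p q : M) : TangentSpace 𝓘(ℝ, E) q →L[ℝ] E :=
  (trivializationAt E (TangentSpace 𝓘(ℝ, E) : M → Type _) p).continuousLinearMapAt ℝ q

/-- The tangent vector at `q` with given coordinates in the preferred trivialization at `p`. -/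
def ofChart (p q : M) : E →L[ℝ] TangentSpace 𝓘(ℝ, E) q :=
  (trivializationAt E (TangentSpace 𝓘(ℝ, E) : M → Type _) p).symmL ℝ q

variable {p q : M}

lemma mem_baseSet_of_mem_source (h : q ∈ (chartAt E p).source) :
    q ∈ (trivializationAt E (TangentSpace 𝓘(ℝ, E) : M → Type _) p).baseSet := h

lemma toChart_ofChart (h : q ∈ (chartAt E p).source) (a : E) :
    toChart p q (ofChart p q a) = a :=
  (trivializationAt E (TangentSpace 𝓘(ℝ, E) : M → Type _) p).continuousLinearMapAt_symmL
    (mem_baseSet_of_mem_source h) a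

lemma ofChart_toChart (h : q ∈ (chartAt E p).source) (v : TangentSpace 𝓘(ℝ, E) q) :
    ofChart p q (toChart p q v) = v :=
  (trivializationAt E (TangentSpace 𝓘(ℝ, E) : M → Type _) p).symmL_continuousLinearMapAt
    (mem_baseSet_of_mem_source h) v

lemma trivializationAt_snd (h : q ∈ (chartAt E p).source) (v : TangentSpace 𝓘(ℝ, E) q) :
    (trivializationAt E (TangentSpace 𝓘(ℝ, E) : M → Type _) p ⟨q, v⟩).2 = toChart p q v := by
  rw [toChart, Bundle.Trivialization.continuousLinearMapAt_apply,
    Bundle.Trivialization.coe_linearMapAt_of_mem _ (mem_baseSet_of_mem_source h)]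

lemma trivializationAt_symm (h : q ∈ (chartAt E p).source) (a : E) :
    (trivializationAt E (TangentSpace 𝓘(ℝ, E) : M → Type _) p).symm q a = ofChart p q a :=
  ((trivializationAt E (TangentSpace 𝓘(ℝ, E) : M → Type _) p).symmL_apply
    (mem_baseSet_of_mem_source h) a).symm

lemma extend_eq_ofChart (v : TangentSpace 𝓘(ℝ, E) p) (h : q ∈ (chartAt E p).source) :
    FiberBundle.extend E v q = ofChart p q (toChart p p v) := by
  rw [← trivializationAt_snd (mem_chart_source E p), ← trivializationAt_symm h]
  rfl

lemma toChart_extend (v : TangentSpace 𝓘(ℝ, E) p) (h : q ∈ (chartAt E p).source) :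
    toChart p q (FiberBundle.extend E v q) = toChart p p v := by
  rw [extend_eq_ofChart v h, toChart_ofChart h]

lemma toChart_apply_eq_mvfderiv (h : q ∈ (chartAt E p).source) (v : TangentSpace 𝓘(ℝ, E) q) :
    toChart p q v = mvfderiv 𝓘(ℝ, E) (extChartAt 𝓘(ℝ, E) p) q v := by
  have := TangentBundle.continuousLinearMapAt_trivializationAt (I := 𝓘(ℝ, E)) h
  rw [toChart, this]
  rfl

omit [IsManifold 𝓘(ℝ, E) ∞ M] in
lemma extChartAt_symm_mem_source {x : E} (hx : x ∈ (extChartAt 𝓘(ℝ, E) p).target) :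
    (extChartAt 𝓘(ℝ, E) p).symm x ∈ (chartAt E p).source := by
  simpa using (extChartAt 𝓘(ℝ, E) p).map_target hx

lemma differentiableAt_comp_extChartAt_symm_iff {h : M → V} {x : E}
    (hx : x ∈ (extChartAt 𝓘(ℝ, E) p).target) :
    DifferentiableAt ℝ (h ∘ (extChartAt 𝓘(ℝ, E) p).symm) x
      ↔ MDifferentiableAt 𝓘(ℝ, E) 𝓘(ℝ, V) h ((extChartAt 𝓘(ℝ, E) p).symm x) := by
  have hs : MDifferentiableAt 𝓘(ℝ, E) 𝓘(ℝ, E) (extChartAt 𝓘(ℝ, E) p).symm x := by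
    have := mdifferentiableWithinAt_extChartAt_symm hx
    rwa [modelWithCornersSelf_coe, Set.range_id, mdifferentiableWithinAt_univ] at this
  constructor
  · intro hd
    have hd' := hd.mdifferentiableAt
    have hc : MDifferentiableAt 𝓘(ℝ, E) 𝓘(ℝ, E) (extChartAt 𝓘(ℝ, E) p)
        ((extChartAt 𝓘(ℝ, E) p).symm x) := mdifferentiableAt_extChartAt (extChartAt_symm_mem_source hx)
    rw [← (extChartAt 𝓘(ℝ, E) p).right_inv hx] at hd'
    have := hd'.comp _ hc
    refine this.congr_of_eventuallyEq ?_
    filter_upwards [(chartAt E p).open_source.mem_nhds (extChartAt_symm_mem_source hx)] with q hq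
    simp only [Function.comp_apply]
    rw [(extChartAt 𝓘(ℝ, E) p).left_inv (by simpa using hq)]
  · intro hd
    exact (hd.comp x hs).differentiableAt

/-- The inverse chart has differential `ofChart p`, at every point of the chart domain and not only
at its centre. -/
lemma fderiv_comp_extChartAt_symm {h : M → V} {x : E}
    (hx : x ∈ (extChartAt 𝓘(ℝ, E) p).target)
    (hh : MDifferentiableAt 𝓘(ℝ, E) 𝓘(ℝ, V) h ((extChartAt 𝓘(ℝ, E) p).symm x)) (u : E) :
    fderiv ℝ (h ∘ (extChartAt 𝓘(ℝ, E) p).symm) x u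
      = mvfderiv 𝓘(ℝ, E) h ((extChartAt 𝓘(ℝ, E) p).symm x) (ofChart p _ u) := by
  have hs : MDifferentiableAt 𝓘(ℝ, E) 𝓘(ℝ, E) (extChartAt 𝓘(ℝ, E) p).symm x := by
    have := mdifferentiableWithinAt_extChartAt_symm hx
    rwa [modelWithCornersSelf_coe, Set.range_id, mdifferentiableWithinAt_univ] at this
  have h1 := mfderiv_comp x hh hs
  rw [mfderiv_eq_fderiv] at h1
  have h2 := TangentBundle.symmL_trivializationAt (I := 𝓘(ℝ, E)) (extChartAt_symm_mem_source hx)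
  rw [modelWithCornersSelf_coe, Set.range_id, mfderivWithin_univ, (extChartAt 𝓘(ℝ, E) p).right_inv hx] at h2
  rw [h1, ofChart, h2]
  rfl

omit [IsManifold 𝓘(ℝ, E) ∞ M] in
lemma eventually_mem_extChartAt_target (p : M) :
    ∀ᶠ x in 𝓝 (extChartAt 𝓘(ℝ, E) p p), x ∈ (extChartAt 𝓘(ℝ, E) p).target :=
  extChartAt_target_mem_nhds p

lemma mdifferentiableAt_section_iff_toChart (h : q ∈ (chartAt E p).source)
    (Z : Π y : M, TangentSpace 𝓘(ℝ, E) y) :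
    MDiffAt (T% Z) q ↔ MDifferentiableAt 𝓘(ℝ, E) 𝓘(ℝ, E) (fun y => toChart p y (Z y)) q := by
  rw [(trivializationAt E (TangentSpace 𝓘(ℝ, E) : M → Type _) p).mdifferentiableAt_section_iff
    𝓘(ℝ, E) Z (mem_baseSet_of_mem_source h)]
  refine Filter.EventuallyEq.mdifferentiableAt_iff ?_
  filter_upwards [(chartAt E p).open_source.mem_nhds h] with y hy
  exact trivializationAt_snd hy _

lemma toChart_ofChart_eventuallyEq (h : q ∈ (chartAt E p).source) (a : E) :
    (fun y => toChart p y (ofChart p y a)) =ᶠ[𝓝 q] fun _ => a := by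
  filter_upwards [(chartAt E p).open_source.mem_nhds h] with y hy
  exact toChart_ofChart hy a

lemma toChart_extend_eventuallyEq (h : q ∈ (chartAt E p).source) (v : TangentSpace 𝓘(ℝ, E) p) :
    (fun y => toChart p y (FiberBundle.extend E v y)) =ᶠ[𝓝 q] fun _ => toChart p p v := by
  filter_upwards [(chartAt E p).open_source.mem_nhds h] with y hy
  exact toChart_extend v hy

lemma mdifferentiableAt_ofChart (h : q ∈ (chartAt E p).source) (a : E) :
    MDiffAt (T% (fun y => ofChart p y a : Π y : M, TangentSpace 𝓘(ℝ, E) y)) q := by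
  rw [mdifferentiableAt_section_iff_toChart h]
  exact mdifferentiableAt_const.congr_of_eventuallyEq (toChart_ofChart_eventuallyEq h a)

lemma ContinuousLinearMap.IsInvertible.inverse_apply_of_eq {V' : Type*} [NormedAddCommGroup V']
    [NormedSpace ℝ V'] {A : V →L[ℝ] V'} (hA : A.IsInvertible) {a : V} {b : V'} (h : A a = b) :
    A.inverse b = a := by
  obtain ⟨e, rfl⟩ := hA
  rw [ContinuousLinearMap.inverse_equiv, ← h]
  simp

/-- Pulled back to the chart, both fields become constant near the centre, so they commute. This
removes the bracket term from every `curvature`. -/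
lemma mlieBracket_extend (v w : TangentSpace 𝓘(ℝ, E) p) :
    VectorField.mlieBracket 𝓘(ℝ, E) (FiberBundle.extend E v) (FiberBundle.extend E w) p = 0 := by
  have key (v : TangentSpace 𝓘(ℝ, E) p) :
      VectorField.mpullbackWithin 𝓘(ℝ, E) 𝓘(ℝ, E) (extChartAt 𝓘(ℝ, E) p).symm
        (FiberBundle.extend E v) (Set.range 𝓘(ℝ, E)) =ᶠ[𝓝 (extChartAt 𝓘(ℝ, E) p p)]
        fun _ => toChart p p v := by
    filter_upwards [eventually_mem_extChartAt_target p] with x hx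
    have hq := extChartAt_symm_mem_source hx
    have h2 := TangentBundle.symmL_trivializationAt (I := 𝓘(ℝ, E)) hq
    rw [(extChartAt 𝓘(ℝ, E) p).right_inv hx] at h2
    refine ContinuousLinearMap.IsInvertible.inverse_apply_of_eq (V := E) (V' := E)
      (isInvertible_mfderivWithin_extChartAt_symm hx) ?_
    rw [extend_eq_ofChart v hq, ofChart, h2]
    rfl
  have h0 := (key v).lieBracketWithin_vectorField_eq_nhds (𝕜 := ℝ) (key w) (s := Set.univ)
  rw [VectorField.mlieBracket, VectorField.mlieBracketWithin_apply]
  simp only [modelWithCornersSelf_coe, Set.range_id, Set.preimage_univ, Set.inter_univ] at h0 ⊢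
  have h1 : VectorField.lieBracketWithin ℝ (fun _ : E => (toChart p p v : E))
      (fun _ : E => (toChart p p w : E)) Set.univ (extChartAt 𝓘(ℝ, E) p p) = 0 := by
    simp [VectorField.lieBracketWithin_eq]
  erw [h0, h1]
  exact map_zero _

end TangentCoordinates

/-! ### Christoffel symbols, and the pull-back connection in a fixed trivialization. -/

section Christoffel

open Filter Topology

variable {E : Type*} [NormedAddCommGroup E] [NormedSpace ℝ E]
  {M : Type*} [TopologicalSpace M] [ChartedSpace E M] [IsManifold 𝓘(ℝ, E) ∞ M]
  {V : Type*} [NormedAddCommGroup V] [NormedSpace ℝ V]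
  {W : Type*} [NormedAddCommGroup W] [NormedSpace ℝ W]

lemma mvfderiv_eq_fderiv_comp {h : M → V} {q : M} (hh : MDifferentiableAt 𝓘(ℝ, E) 𝓘(ℝ, V) h q)
    (v : TangentSpace 𝓘(ℝ, E) q) :
    mvfderiv 𝓘(ℝ, E) h q v
      = fderiv ℝ (h ∘ (extChartAt 𝓘(ℝ, E) q).symm) (extChartAt 𝓘(ℝ, E) q q) (toChart q q v) := by
  have hx : extChartAt 𝓘(ℝ, E) q q ∈ (extChartAt 𝓘(ℝ, E) q).target := mem_extChartAt_target q
  have hq : (extChartAt 𝓘(ℝ, E) q).symm (extChartAt 𝓘(ℝ, E) q q) = q := extChartAt_to_inv q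
  have := fderiv_comp_extChartAt_symm (h := h) hx (by rwa [hq]) (toChart q q v)
  rw [hq, ofChart_toChart (mem_chart_source E q)] at this
  exact this.symm

lemma differentiableAt_comp_extChartAt_symm_self {h : M → V} {q : M}
    (hh : MDifferentiableAt 𝓘(ℝ, E) 𝓘(ℝ, V) h q) :
    DifferentiableAt ℝ (h ∘ (extChartAt 𝓘(ℝ, E) q).symm) (extChartAt 𝓘(ℝ, E) q q) := by
  rw [differentiableAt_comp_extChartAt_symm_iff (mem_extChartAt_target q), extChartAt_to_inv q]
  exact hh

lemma mvfderiv_clm_apply {B : M → V →L[ℝ] W} {s : M → V} {q : M}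
    (hB : MDifferentiableAt 𝓘(ℝ, E) 𝓘(ℝ, V →L[ℝ] W) B q)
    (hs : MDifferentiableAt 𝓘(ℝ, E) 𝓘(ℝ, V) s q) (v : TangentSpace 𝓘(ℝ, E) q) :
    mvfderiv 𝓘(ℝ, E) (fun y => B y (s y)) q v
      = mvfderiv 𝓘(ℝ, E) B q v (s q) + B q (mvfderiv 𝓘(ℝ, E) s q v) := by
  rw [mvfderiv_eq_fderiv_comp (hB.clm_apply hs), mvfderiv_eq_fderiv_comp hB,
    mvfderiv_eq_fderiv_comp hs]
  have h := (differentiableAt_comp_extChartAt_symm_self hB).hasFDerivAt.clm_apply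
    (differentiableAt_comp_extChartAt_symm_self hs).hasFDerivAt
  have h' := h.fderiv
  simp only [Function.comp_apply, extChartAt_to_inv] at h'
  change fderiv ℝ (fun y => (B ∘ _) y ((s ∘ _) y)) _ _ = _
  simp only [Function.comp_apply]
  rw [h']
  simp
  abel

omit [IsManifold 𝓘(ℝ, E) ∞ M] in
lemma Filter.EventuallyEq.mvfderiv_eq {h h' : M → V} {q : M} (e : h =ᶠ[𝓝 q] h') :
    mvfderiv 𝓘(ℝ, E) h q = mvfderiv 𝓘(ℝ, E) h' q := by
  ext v
  have := e.mfderiv_eq (I := 𝓘(ℝ, E)) (I' := 𝓘(ℝ, V))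
  exact congrArg (fun L : E →L[ℝ] V => L v) this

/-- The connection for which the preferred trivialization at `p` is parallel. -/
def flatConnection (p : M) (σ : Π y : M, TangentSpace 𝓘(ℝ, E) y) (y : M) :
    TangentSpace 𝓘(ℝ, E) y →L[ℝ] TangentSpace 𝓘(ℝ, E) y :=
  (ofChart p y).comp (mvfderiv 𝓘(ℝ, E) (fun z => toChart p z (σ z)) y)

/-- Two covariant derivatives on the same set differ by a tensor; the difference from this one is
the Christoffel symbol. -/
lemma isCovariantDerivativeOn_flatConnection (p : M) :
    IsCovariantDerivativeOn E (flatConnection (E := E) p) (chartAt E p).source where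
  add {σ σ' x} hσ hσ' hx := by
    rw [mdifferentiableAt_section_iff_toChart hx] at hσ hσ'
    have : (fun z => toChart p z ((σ + σ') z)) = fun z => toChart p z (σ z) + toChart p z (σ' z) := by
      ext z; simp
    rw [flatConnection, this, mvfderiv_fun_add hσ hσ', ContinuousLinearMap.comp_add]
    rfl
  leibniz {σ g x} hσ hg hx := by
    have hσ' := hσ
    rw [mdifferentiableAt_section_iff_toChart hx] at hσ
    have : (fun z => toChart p z ((g • σ) z)) = fun z => g z • toChart p z (σ z) := by
      ext z; simp
    ext v
    rw [flatConnection, this, mvfderiv_fun_smul hg hσ]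
    simp [flatConnection, ofChart_toChart hx]

variable [FiniteDimensional ℝ E]

/-- The Christoffel symbols of a connection in the preferred trivialization at `p`. -/
def christoffel (cov : CovariantDerivative 𝓘(ℝ, E) E (TangentSpace 𝓘(ℝ, E) : M → Type _))
    (p y : M) : E →L[ℝ] E →L[ℝ] E :=
  LinearMap.toContinuousLinearMap
    { toFun := fun a => ((toChart p y).comp
        ((cov.isCovariantDerivativeOn (s := (chartAt E p).source)).difference
          (isCovariantDerivativeOn_flatConnection p) y (ofChart p y a))).comp (ofChart p y)
      map_add' := fun a b => by ext c; simp
      map_smul' := fun a b => by ext c; simp }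

variable (cov : CovariantDerivative 𝓘(ℝ, E) E (TangentSpace 𝓘(ℝ, E) : M → Type _)) {p q : M}

/-- A connection in the preferred trivialization at `p`. -/
lemma toChart_cov (h : q ∈ (chartAt E p).source) {Z : Π y : M, TangentSpace 𝓘(ℝ, E) y}
    (hZ : MDifferentiableAt 𝓘(ℝ, E) 𝓘(ℝ, E) (fun y => toChart p y (Z y)) q)
    (v : TangentSpace 𝓘(ℝ, E) q) :
    toChart p q (cov Z q v) = mvfderiv 𝓘(ℝ, E) (fun y => toChart p y (Z y)) q v
      + christoffel cov p q (toChart p q (Z q)) (toChart p q v) := by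
  have h1 : christoffel cov p q (toChart p q (Z q)) (toChart p q v)
      = toChart p q ((cov.isCovariantDerivativeOn (s := (chartAt E p).source)).difference
          (isCovariantDerivativeOn_flatConnection p) q (ofChart p q (toChart p q (Z q)))
            (ofChart p q (toChart p q v))) := rfl
  -- Tensoriality: the difference at `q` depends only on the value `Z q`, so it may be evaluated on
  -- the field `Z` itself.
  rw [h1, ofChart_toChart h, ofChart_toChart h, IsCovariantDerivativeOn.difference_apply _ _ h
    ((mdifferentiableAt_section_iff_toChart h Z).2 hZ)]
  simp only [sub_apply, map_sub]
  have : toChart p q (flatConnection p Z q v) = mvfderiv 𝓘(ℝ, E) (fun y => toChart p y (Z y)) q v :=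
    toChart_ofChart h _
  rw [this]
  abel

omit [FiniteDimensional ℝ E] in
-- `derivAlong` at x is defined with the trivialization at f x, which moves with x; computing in a
-- single chart requires differentiating the change of trivialization.
lemma mdifferentiableAt_transition {p p' : M} (h : q ∈ (chartAt E p).source)
    (h' : q ∈ (chartAt E p').source) :
    MDifferentiableAt 𝓘(ℝ, E) 𝓘(ℝ, E →L[ℝ] E)
      (fun y => (toChart (E := E) p' y).comp (ofChart (E := E) p y)) q := by
  have := mdifferentiableAt_coordChangeL (IB := 𝓘(ℝ, E))
    (e := trivializationAt E (TangentSpace 𝓘(ℝ, E) : M → Type _) p)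
    (e' := trivializationAt E (TangentSpace 𝓘(ℝ, E) : M → Type _) p')
    (mem_baseSet_of_mem_source h) (mem_baseSet_of_mem_source h')
  refine this.congr_of_eventuallyEq ?_
  filter_upwards [(chartAt E p).open_source.mem_nhds h, (chartAt E p').open_source.mem_nhds h']
    with y hy hy'
  ext a
  have := (trivializationAt E (TangentSpace 𝓘(ℝ, E) : M → Type _) p).coordChangeL_apply (R := ℝ)
    (trivializationAt E (TangentSpace 𝓘(ℝ, E) : M → Type _) p')
    ⟨mem_baseSet_of_mem_source hy, mem_baseSet_of_mem_source hy'⟩ a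
  rw [trivializationAt_symm hy, trivializationAt_snd hy'] at this
  exact this.symm

variable {E' : Type*} [NormedAddCommGroup E'] [NormedSpace ℝ E']
  {M' : Type*} [TopologicalSpace M'] [ChartedSpace E' M'] [IsManifold 𝓘(ℝ, E') ∞ M']

/-- The pull-back connection in the preferred trivialization at `p`. -/
lemma toChart_derivAlong {f : M' → M} {x : M'} (h : f x ∈ (chartAt E p).source)
    (hf : MDifferentiableAt 𝓘(ℝ, E') 𝓘(ℝ, E) f x) {s : Π y : M', TangentSpace 𝓘(ℝ, E) (f y)}
    (hs : MDifferentiableAt 𝓘(ℝ, E') 𝓘(ℝ, E) (fun y => toChart p (f y) (s y)) x)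
    (v : TangentSpace 𝓘(ℝ, E') x) :
    toChart p (f x) (derivAlong cov f s x v)
      = mvfderiv 𝓘(ℝ, E') (fun y => toChart p (f y) (s y)) x v
        + christoffel cov p (f x) (toChart p (f x) (s x))
          (toChart p (f x) (mfderiv 𝓘(ℝ, E') 𝓘(ℝ, E) f x v)) := by
  have h' := mem_chart_source E (f x)
  have hU : ∀ᶠ y in 𝓝 x, f y ∈ (chartAt E p).source :=
    hf.continuousAt.preimage_mem_nhds ((chartAt E p).open_source.mem_nhds h)
  have hU' : ∀ᶠ y in 𝓝 x, f y ∈ (chartAt E (f x)).source :=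
    hf.continuousAt.preimage_mem_nhds ((chartAt E (f x)).open_source.mem_nhds h')
  set B : M → E →L[ℝ] E := fun y => (toChart p y).comp (ofChart (f x) y) with hBdef
  have hB : MDifferentiableAt 𝓘(ℝ, E) 𝓘(ℝ, E →L[ℝ] E) B (f x) := mdifferentiableAt_transition h' h
  have hBf : MDifferentiableAt 𝓘(ℝ, E') 𝓘(ℝ, E →L[ℝ] E) (B ∘ f) x := hB.comp x hf
  have hs1 : MDifferentiableAt 𝓘(ℝ, E') 𝓘(ℝ, E) (fun y => toChart (f x) (f y) (s y)) x := by
    have hB' := (mdifferentiableAt_transition h h').comp x hf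
    refine (hB'.clm_apply hs).congr_of_eventuallyEq ?_
    filter_upwards [hU] with y hy
    simp [ofChart_toChart hy]
  have e1 : (fun y => toChart p (f y) (s y)) =ᶠ[𝓝 x]
      fun y => (B ∘ f) y (toChart (f x) (f y) (s y)) := by
    filter_upwards [hU'] with y hy
    simp [B, ofChart_toChart hy]
  -- The extension of `s x` has constant coordinates at f x but not at p. The derivative of `B` it
  -- produces is the one given by the product rule for s, so the two sides agree.
  have e2 : (fun y => toChart p y (FiberBundle.extend E (s x) y)) =ᶠ[𝓝 (f x)]
      fun y => B y (toChart (f x) (f x) (s x)) := by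
    filter_upwards [(chartAt E (f x)).open_source.mem_nhds h'] with y hy
    simp [B, extend_eq_ofChart (s x) hy]
  have hd2 : MDifferentiableAt 𝓘(ℝ, E) 𝓘(ℝ, E)
      (fun y => toChart p y (FiberBundle.extend E (s x) y)) (f x) :=
    (hB.clm_apply mdifferentiableAt_const).congr_of_eventuallyEq e2
  have e3 : (fun y => (trivializationAt E (TangentSpace 𝓘(ℝ, E) : M → Type _) (f x) ⟨f y, s y⟩).2)
      =ᶠ[𝓝 x] fun y => toChart (f x) (f y) (s y) := by
    filter_upwards [hU'] with y hy
    exact trivializationAt_snd hy _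
  have e4 : mvfderiv 𝓘(ℝ, E') (B ∘ f) x v
      = mvfderiv 𝓘(ℝ, E) B (f x) (mfderiv 𝓘(ℝ, E') 𝓘(ℝ, E) f x v) :=
    mfderiv_comp_apply x hB hf v
  rw [derivAlong, map_add, toChart_cov cov h hd2, e1.mvfderiv_eq, mvfderiv_clm_apply hBf hs1, e4,
    e2.mvfderiv_eq, mvfderiv_clm_apply hB mdifferentiableAt_const, mvfderiv_const,
    e3.mvfderiv_eq, trivializationAt_symm h', FiberBundle.extend_apply_self]
  simp [B]
  abel

end Christoffel

/-! ### Smoothness, duality, curvature and torsion in coordinates. -/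

section ChartTensors

open Filter Topology

variable {E : Type*} [NormedAddCommGroup E] [NormedSpace ℝ E] [FiniteDimensional ℝ E]
  {M : Type*} [TopologicalSpace M] [ChartedSpace E M] [IsManifold 𝓘(ℝ, E) ∞ M]
  {V : Type*} [NormedAddCommGroup V] [NormedSpace ℝ V]
  {W : Type*} [NormedAddCommGroup W] [NormedSpace ℝ W]

/-- In finite dimension the operator is a finite sum of coordinate functionals times its values on a
basis. -/
lemma contDiffAt_clm_of_apply {A : V → E →L[ℝ] W} {x : V} {n : WithTop ℕ∞}
    (h : ∀ a, ContDiffAt ℝ n (fun y => A y a) x) : ContDiffAt ℝ n A x := by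
  let b := Module.finBasis ℝ E
  have : A = fun y => ∑ i, (LinearMap.toContinuousLinearMap (b.coord i)).smulRight (A y (b i)) := by
    ext y a
    conv_lhs => rw [← b.sum_repr a]
    simp [-Module.Basis.sum_repr]
  rw [this]
  refine ContDiffAt.sum fun i _ => ?_
  exact ((ContinuousLinearMap.smulRightL ℝ E W
    (LinearMap.toContinuousLinearMap (b.coord i))).contDiff.contDiffAt).comp x (h (b i))

omit [FiniteDimensional ℝ E] [IsManifold 𝓘(ℝ, E) ∞ M] in
lemma ContMDiffAt.contDiffAt_comp_extChartAt_symm {h : M → V} {p : M} {n : ℕ∞}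
    (hh : ContMDiffAt 𝓘(ℝ, E) 𝓘(ℝ, V) n h p) :
    ContDiffAt ℝ n (h ∘ (extChartAt 𝓘(ℝ, E) p).symm) (extChartAt 𝓘(ℝ, E) p p) := by
  have := (contMDiffAt_iff.1 hh).2
  simp only [modelWithCornersSelf_coe, Set.range_id] at this
  exact contDiffWithinAt_univ.1 this

/-- The Christoffel symbols of a connection in the preferred chart at `p`. -/
def chartChristoffel (cov : CovariantDerivative 𝓘(ℝ, E) E (TangentSpace 𝓘(ℝ, E) : M → Type _))
    (p : M) : E → E →L[ℝ] E →L[ℝ] E :=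
  christoffel cov p ∘ (extChartAt 𝓘(ℝ, E) p).symm

/-- The coefficients of a metric in the preferred trivialization at `p`. -/
def metricCoeff
    (g : Bundle.ContMDiffRiemannianMetric 𝓘(ℝ, E) ∞ E (TangentSpace 𝓘(ℝ, E) : M → Type _))
    (p y : M) : E →L[ℝ] E →L[ℝ] ℝ :=
  LinearMap.toContinuousLinearMap
    { toFun := fun a => (g.inner y (ofChart p y a)).comp (ofChart p y)
      map_add' := fun a b => by ext c; simp
      map_smul' := fun a b => by ext c; simp }

/-- The coefficients of a metric in the preferred chart at `p`. -/
def chartMetric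
    (g : Bundle.ContMDiffRiemannianMetric 𝓘(ℝ, E) ∞ E (TangentSpace 𝓘(ℝ, E) : M → Type _))
    (p : M) : E → E →L[ℝ] E →L[ℝ] ℝ :=
  metricCoeff g p ∘ (extChartAt 𝓘(ℝ, E) p).symm

variable (cov cov' : CovariantDerivative 𝓘(ℝ, E) E (TangentSpace 𝓘(ℝ, E) : M → Type _))
  (g : Bundle.ContMDiffRiemannianMetric 𝓘(ℝ, E) ∞ E (TangentSpace 𝓘(ℝ, E) : M → Type _)) {p q : M}

lemma metricCoeff_apply (a b : E) :
    metricCoeff g p q a b = g.inner q (ofChart p q a) (ofChart p q b) := rfl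

lemma metricCoeff_toChart (h : q ∈ (chartAt E p).source) (v w : TangentSpace 𝓘(ℝ, E) q) :
    metricCoeff g p q (toChart p q v) (toChart p q w) = g.inner q v w := by
  rw [metricCoeff_apply, ofChart_toChart h, ofChart_toChart h]

lemma toChart_cov_ofChart (h : q ∈ (chartAt E p).source) (a b : E) :
    toChart p q (cov (fun y => ofChart p y a) q (ofChart p q b)) = christoffel cov p q a b := by
  have hd : MDifferentiableAt 𝓘(ℝ, E) 𝓘(ℝ, E) (fun y => toChart p y (ofChart p y a)) q :=
    mdifferentiableAt_const.congr_of_eventuallyEq (toChart_ofChart_eventuallyEq h a)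
  rw [toChart_cov cov h hd, (toChart_ofChart_eventuallyEq h a).mvfderiv_eq, mvfderiv_const,
    toChart_ofChart h, toChart_ofChart h]
  simp

lemma toChart_cov_extend (h : q ∈ (chartAt E p).source) (w : TangentSpace 𝓘(ℝ, E) p)
    (v : TangentSpace 𝓘(ℝ, E) q) :
    toChart p q (cov (FiberBundle.extend E w) q v)
      = christoffel cov p q (toChart p p w) (toChart p q v) := by
  have hd : MDifferentiableAt 𝓘(ℝ, E) 𝓘(ℝ, E)
      (fun y => toChart p y (FiberBundle.extend E w y)) q :=
    mdifferentiableAt_const.congr_of_eventuallyEq (toChart_extend_eventuallyEq h w)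
  rw [toChart_cov cov h hd, (toChart_extend_eventuallyEq h w).mvfderiv_eq, mvfderiv_const,
    toChart_extend w h]
  simp

variable {cov} in
-- On a field with constant coordinates a the connection reduces to Γ(a, ·), and smoothness of the
-- connection makes its value on a smooth field a smooth section of the Hom bundle.
lemma contMDiffAt_christoffel
    (hcov : ∀ U : Set M, IsOpen U → ContMDiffCovariantDerivativeOn E ∞ cov.toFun U) (a : E) :
    ContMDiffAt 𝓘(ℝ, E) 𝓘(ℝ, E →L[ℝ] E) ∞ (fun y => christoffel cov p y a) p := by
  obtain ⟨s, hs, hsm⟩ := FiberBundle.exists_contMDiffOn_extend (k := ∞) 𝓘(ℝ, E) E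
    (ofChart p p a : TangentSpace 𝓘(ℝ, E) p)
  obtain ⟨U, hUs, hUo, hpU⟩ := mem_nhds_iff.1 hs
  have h1 := (hcov U hUo).contMDiff (σ := FiberBundle.extend E (ofChart p p a))
    ((hsm.mono hUs).of_le (by simp))
  have h2 := ((h1 p hpU).contMDiffAt (hUo.mem_nhds hpU))
  rw [contMDiffAt_hom_bundle] at h2
  refine h2.2.congr_of_eventuallyEq ?_
  filter_upwards [(chartAt E p).open_source.mem_nhds (mem_chart_source E p)] with y hy
  ext b
  have := toChart_cov_extend cov hy (ofChart p p a) (ofChart p y b)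
  rw [toChart_ofChart (mem_chart_source E p), toChart_ofChart hy] at this
  exact this.symm

variable {cov} in
lemma differentiableAt_chartChristoffel
    (hcov : ∀ U : Set M, IsOpen U → ContMDiffCovariantDerivativeOn E ∞ cov.toFun U) (p : M) :
    DifferentiableAt ℝ (chartChristoffel cov p) (extChartAt 𝓘(ℝ, E) p p) := by
  refine (contDiffAt_clm_of_apply (n := ∞) fun a => ?_).differentiableAt (by simp)
  exact (contMDiffAt_christoffel hcov a).contDiffAt_comp_extChartAt_symm

lemma contDiffAt_chartMetric (p : M) :
    ContDiffAt ℝ ∞ (chartMetric g p) (extChartAt 𝓘(ℝ, E) p p) := by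
  refine contDiffAt_clm_of_apply fun a => contDiffAt_clm_of_apply fun b => ?_
  refine ContMDiffAt.contDiffAt_comp_extChartAt_symm (h := fun y => metricCoeff g p y a b) ?_
  have h1 (a : E) := FiberBundle.contMDiffAt_extend (k := ∞) 𝓘(ℝ, E) E
    (ofChart p p a : TangentSpace 𝓘(ℝ, E) p)
  have h2 := ContMDiffAt.clm_bundle_apply₂ (F₁ := E) (F₂ := E) (F₃ := ℝ)
    (E₃ := fun _ : M => ℝ) (b := id)
    (g.contMDiff p) (h1 a) (h1 b)
  refine ContMDiffAt.congr_of_eventuallyEq (Bundle.contMDiffAt_totalSpace.1 h2).2 ?_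
  filter_upwards [(chartAt E p).open_source.mem_nhds (mem_chart_source E p)] with y hy
  rw [extend_eq_ofChart _ hy, extend_eq_ofChart _ hy, toChart_ofChart (mem_chart_source E p),
    toChart_ofChart (mem_chart_source E p)]
  rfl

/-- Two connections are dual to each other with respect to a metric. -/
def IsDualPair : Prop :=
  ∀ (x : M) (X Y Z : Π y : M, TangentSpace 𝓘(ℝ, E) y),
    MDiffAt (T% Y) x → MDiffAt (T% Z) x →
    mvfderiv 𝓘(ℝ, E) (fun y => g.inner y (Y y) (Z y)) x (X x)
      = g.inner x (cov Y x (X x)) (Z x) + g.inner x (Y x) (cov' Z x (X x))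

variable {cov cov' g} in
-- The duality identity evaluated on fields with constant coordinates. It holds on a whole
-- neighbourhood because it is differentiated once more for the curvature.
lemma fderiv_chartMetric (h : IsDualPair cov cov' g) (p : M) :
    ∀ᶠ x in 𝓝 (extChartAt 𝓘(ℝ, E) p p), ∀ u a b, fderiv ℝ (chartMetric g p) x u a b
      = chartMetric g p x (chartChristoffel cov p x a u) b
        + chartMetric g p x a (chartChristoffel cov' p x b u) := by
  filter_upwards [eventually_mem_extChartAt_target p,
    ((contDiffAt_chartMetric g p).of_le (m := 1) (by simp)).eventually (by simp)]
    with x hx hd u a b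
  have hq := extChartAt_symm_mem_source hx
  have hd1 := hd.differentiableAt (by simp)
  have h1 : fderiv ℝ (chartMetric g p) x u a b
      = fderiv ℝ (fun y => chartMetric g p y a b) x u := by
    have := ((hd1.hasFDerivAt.clm_apply (hasFDerivAt_const a x)).clm_apply
      (hasFDerivAt_const b x)).fderiv
    rw [this]
    simp
  have hd2 : DifferentiableAt ℝ ((fun y => metricCoeff g p y a b) ∘ (extChartAt 𝓘(ℝ, E) p).symm) x :=
    (hd1.clm_apply (differentiableAt_const a)).clm_apply (differentiableAt_const b)
  have h2 := fderiv_comp_extChartAt_symm hx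
    ((differentiableAt_comp_extChartAt_symm_iff hx).1 hd2) u
  have h3 := h ((extChartAt 𝓘(ℝ, E) p).symm x) (fun y => ofChart p y u) (fun y => ofChart p y a)
    (fun y => ofChart p y b) (mdifferentiableAt_ofChart hq a) (mdifferentiableAt_ofChart hq b)
  rw [h1]
  refine h2.trans (h3.trans ?_)
  rw [← metricCoeff_toChart g hq, ← metricCoeff_toChart g hq, toChart_cov_ofChart cov hq,
    toChart_cov_ofChart cov' hq, toChart_ofChart hq, toChart_ofChart hq]
  rfl

set_option synthInstance.maxHeartbeats 200000 in
/-- The curvature tensor in the preferred chart. -/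
lemma toChart_curvature
    (hcov : DifferentiableAt ℝ (chartChristoffel cov p) (extChartAt 𝓘(ℝ, E) p p))
    (u v w : TangentSpace 𝓘(ℝ, E) p) :
    toChart p p (curvature cov.op p u v w)
      = chartCurv (chartChristoffel cov p) id (extChartAt 𝓘(ℝ, E) p p) (toChart p p u)
          (toChart p p v) (toChart p p w) := by
  have hp := mem_chart_source E p
  have hx : extChartAt 𝓘(ℝ, E) p p ∈ (extChartAt 𝓘(ℝ, E) p).target := mem_extChartAt_target p
  -- Near p the inner derivative has coordinates Γ(w, v), so the outer one gives ∂_u Γ(w, v) +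
  -- Γ(Γ(w, v), u).
  have key (u v : TangentSpace 𝓘(ℝ, E) p) :
      toChart p p (cov (fun y => cov (FiberBundle.extend E w) y (FiberBundle.extend E v y)) p u)
        = fderiv ℝ (chartChristoffel cov p) (extChartAt 𝓘(ℝ, E) p p) (toChart p p u)
            (toChart p p w) (toChart p p v)
          + christoffel cov p p (christoffel cov p p (toChart p p w) (toChart p p v))
            (toChart p p u) := by
    have e : (fun y => toChart p y (cov (FiberBundle.extend E w) y (FiberBundle.extend E v y)))
        =ᶠ[𝓝 p] fun y => christoffel cov p y (toChart p p w) (toChart p p v) := by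
      filter_upwards [(chartAt E p).open_source.mem_nhds hp] with y hy
      rw [toChart_cov_extend cov hy, toChart_extend v hy]
    have hd : DifferentiableAt ℝ ((fun y => christoffel cov p y (toChart p p w) (toChart p p v))
        ∘ (extChartAt 𝓘(ℝ, E) p).symm) (extChartAt 𝓘(ℝ, E) p p) :=
      (hcov.clm_apply (differentiableAt_const _)).clm_apply (differentiableAt_const _)
    have hm := (differentiableAt_comp_extChartAt_symm_iff hx).1 hd
    rw [extChartAt_to_inv p] at hm
    rw [toChart_cov cov hp (hm.congr_of_eventuallyEq e), e.mvfderiv_eq, mvfderiv_eq_fderiv_comp hm,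
      toChart_cov_extend cov hp, FiberBundle.extend_apply_self]
    congr 1
    have := ((hcov.hasFDerivAt.clm_apply (hasFDerivAt_const (toChart p p w) _)).clm_apply
      (hasFDerivAt_const (toChart p p v) _)).fderiv
    refine (congrArg (fun L : E →L[ℝ] E => L (toChart p p u)) this).trans ?_
    simp
  have e0 : chartChristoffel cov p (extChartAt 𝓘(ℝ, E) p p) = christoffel cov p p := by
    rw [chartChristoffel, Function.comp_apply, extChartAt_to_inv p]
  rw [curvature, curvatureField, mlieBracket_extend]
  simp only [CovariantDerivative.op, FiberBundle.extend_apply_self, map_zero, sub_zero, map_sub]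
  rw [key, key, chartCurv, e0, fderiv_id]
  simp only [ContinuousLinearMap.id_apply]
  abel

variable {cov} in
-- Fields with constant coordinates commute, so on them the torsion is the antisymmetric part of Γ.
lemma christoffel_symm (hcov : cov.torsion = 0) (a b : E) :
    christoffel cov p p a b = christoffel cov p p b a := by
  have hp := mem_chart_source E p
  have h := cov.torsion_apply_eq_extend (x := p) (ofChart p p b) (ofChart p p a)
  rw [hcov, mlieBracket_extend, FiberBundle.extend_apply_self, FiberBundle.extend_apply_self] at h
  have h' := congrArg (toChart p p) h
  rw [sub_zero, map_sub, toChart_cov_extend cov hp, toChart_cov_extend cov hp,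
    toChart_ofChart hp, toChart_ofChart hp] at h'
  have h0 : toChart p p ((0 : (x : M) → TangentSpace 𝓘(ℝ, E) x →L[ℝ] TangentSpace 𝓘(ℝ, E) x →L[ℝ]
      TangentSpace 𝓘(ℝ, E) x) p (ofChart p p b) (ofChart p p a)) = 0 := map_zero _
  rw [h0] at h'
  exact (sub_eq_zero.1 h'.symm)

end ChartTensors

/-! ### The Gauss equation of a submanifold. -/

section Gauss

set_option synthInstance.maxHeartbeats 200000

open Filter Topology

variable {E : Type*} [NormedAddCommGroup E] [NormedSpace ℝ E] [FiniteDimensional ℝ E]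
  {M : Type*} [TopologicalSpace M] [ChartedSpace E M] [IsManifold 𝓘(ℝ, E) ∞ M]
  {E' : Type*} [NormedAddCommGroup E'] [NormedSpace ℝ E'] [FiniteDimensional ℝ E']
  {N : Type*} [TopologicalSpace N] [ChartedSpace E' N] [IsManifold 𝓘(ℝ, E') ∞ N]

omit [FiniteDimensional ℝ E] [FiniteDimensional ℝ E'] in
lemma chartDeriv_congr {Γ : E → E' →L[ℝ] E' →L[ℝ] E'} {F s s' : E → E'} {x : E}
    (h : s =ᶠ[𝓝 x] s') (v : E) : chartDeriv Γ F s v x = chartDeriv Γ F s' v x := by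
  rw [chartDeriv, chartDeriv, h.fderiv_eq, h.self_of_nhds]

omit [FiniteDimensional ℝ E] [FiniteDimensional ℝ E'] in
-- Chain rule: the curvature of the pull-back connection is the pull-back of the curvature.
lemma chartCurv_comp {Γ : E' → E' →L[ℝ] E' →L[ℝ] E'} {F : E → E'} {x : E}
    (hΓ : DifferentiableAt ℝ Γ (F x)) (hF : DifferentiableAt ℝ F x) (u v : E) (a : E') :
    chartCurv (Γ ∘ F) F x u v a
      = chartCurv Γ id (F x) (fderiv ℝ F x u) (fderiv ℝ F x v) a := by
  simp [chartCurv, fderiv_comp (G := E' →L[ℝ] E' →L[ℝ] E') (g := Γ) x hΓ hF, fderiv_id]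

/-- A map between manifolds, read in the preferred charts. -/
def chartMap (f : M → N) (p : M) : E → E' :=
  extChartAt 𝓘(ℝ, E') (f p) ∘ f ∘ (extChartAt 𝓘(ℝ, E) p).symm

variable {f : M → N}

omit [FiniteDimensional ℝ E] [FiniteDimensional ℝ E'] [IsManifold 𝓘(ℝ, E) ∞ M]
  [IsManifold 𝓘(ℝ, E') ∞ N] in
lemma chartMap_self (p : M) : chartMap (E := E) (E' := E') f p (extChartAt 𝓘(ℝ, E) p p)
    = extChartAt 𝓘(ℝ, E') (f p) (f p) := by
  rw [chartMap, Function.comp_apply, Function.comp_apply, extChartAt_to_inv p]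

omit [FiniteDimensional ℝ E] [FiniteDimensional ℝ E'] [IsManifold 𝓘(ℝ, E) ∞ M]
  [IsManifold 𝓘(ℝ, E') ∞ N] in
lemma contDiffAt_chartMap (hf : ContMDiff 𝓘(ℝ, E) 𝓘(ℝ, E') ∞ f) (p : M) :
    ContDiffAt ℝ ∞ (chartMap (E := E) (E' := E') f p) (extChartAt 𝓘(ℝ, E) p p) := by
  have := (contMDiffAt_iff.1 (hf p)).2
  simp only [modelWithCornersSelf_coe, Set.range_id] at this
  exact contDiffWithinAt_univ.1 this

omit [FiniteDimensional ℝ E] [FiniteDimensional ℝ E'] [IsManifold 𝓘(ℝ, E) ∞ M]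
  [IsManifold 𝓘(ℝ, E') ∞ N] in
lemma eventually_mem_chart_source (hf : ContMDiff 𝓘(ℝ, E) 𝓘(ℝ, E') ∞ f) (p : M) :
    ∀ᶠ x in 𝓝 (extChartAt 𝓘(ℝ, E) p p),
      f ((extChartAt 𝓘(ℝ, E) p).symm x) ∈ (chartAt E' (f p)).source := by
  have hc : ContinuousAt (extChartAt 𝓘(ℝ, E) p).symm (extChartAt 𝓘(ℝ, E) p p) :=
    continuousAt_extChartAt_symm p
  have h2 : ContinuousAt (f ∘ (extChartAt 𝓘(ℝ, E) p).symm) (extChartAt 𝓘(ℝ, E) p p) :=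
    hf.continuous.continuousAt.comp hc
  refine h2.preimage_mem_nhds ((chartAt E' (f p)).open_source.mem_nhds ?_)
  rw [Function.comp_apply, extChartAt_to_inv p]
  exact mem_chart_source E' (f p)

omit [FiniteDimensional ℝ E] [FiniteDimensional ℝ E'] in
lemma fderiv_chartMap (hf : ContMDiff 𝓘(ℝ, E) 𝓘(ℝ, E') ∞ f) {p : M} {x : E}
    (hx : x ∈ (extChartAt 𝓘(ℝ, E) p).target)
    (hy : f ((extChartAt 𝓘(ℝ, E) p).symm x) ∈ (chartAt E' (f p)).source) (u : E) :
    fderiv ℝ (chartMap f p) x u = toChart (f p) (f ((extChartAt 𝓘(ℝ, E) p).symm x))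
      (mfderiv 𝓘(ℝ, E) 𝓘(ℝ, E') f ((extChartAt 𝓘(ℝ, E) p).symm x) (ofChart p _ u)) := by
  have hfd : MDifferentiableAt 𝓘(ℝ, E) 𝓘(ℝ, E') f ((extChartAt 𝓘(ℝ, E) p).symm x) :=
    hf.mdifferentiable (by simp) _
  have hc : MDifferentiableAt 𝓘(ℝ, E') 𝓘(ℝ, E') (extChartAt 𝓘(ℝ, E') (f p))
      (f ((extChartAt 𝓘(ℝ, E) p).symm x)) := mdifferentiableAt_extChartAt hy
  have h1 := fderiv_comp_extChartAt_symm hx (hc.comp _ hfd) u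
  refine h1.trans ?_
  rw [toChart_apply_eq_mvfderiv hy]
  exact mfderiv_comp_apply _ hc hfd _

omit [FiniteDimensional ℝ E] [FiniteDimensional ℝ E'] in
lemma fderiv_chartMap_toChart (hf : ContMDiff 𝓘(ℝ, E) 𝓘(ℝ, E') ∞ f) {p : M} {x : E}
    (hx : x ∈ (extChartAt 𝓘(ℝ, E) p).target)
    (hy : f ((extChartAt 𝓘(ℝ, E) p).symm x) ∈ (chartAt E' (f p)).source)
    (v : TangentSpace 𝓘(ℝ, E) ((extChartAt 𝓘(ℝ, E) p).symm x)) :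
    toChart (f p) (f ((extChartAt 𝓘(ℝ, E) p).symm x))
      (mfderiv 𝓘(ℝ, E) 𝓘(ℝ, E') f ((extChartAt 𝓘(ℝ, E) p).symm x) v)
      = fderiv ℝ (chartMap f p) x (toChart p _ v) := by
  rw [fderiv_chartMap hf hx hy, ofChart_toChart (extChartAt_symm_mem_source hx)]

omit [FiniteDimensional ℝ E] [FiniteDimensional ℝ E'] in
lemma fderiv_chartMap_self (hf : ContMDiff 𝓘(ℝ, E) 𝓘(ℝ, E') ∞ f) (p : M)
    (v : TangentSpace 𝓘(ℝ, E) p) :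
    toChart (f p) (f p) (mfderiv 𝓘(ℝ, E) 𝓘(ℝ, E') f p v)
      = fderiv ℝ (chartMap f p) (extChartAt 𝓘(ℝ, E) p p) (toChart p p v) := by
  have := fderiv_chartMap_toChart hf (p := p) (mem_extChartAt_target p)
    (by rw [extChartAt_to_inv p]; exact mem_chart_source E' (f p))
  rw [extChartAt_to_inv p] at this
  exact this v

omit [FiniteDimensional ℝ E] in
/-- The derivative of a tangent field along `f`, in coordinates. -/
lemma eventually_toChart_derivAlong_pushAlong
    (cov : CovariantDerivative 𝓘(ℝ, E') E' (TangentSpace 𝓘(ℝ, E') : N → Type _))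
    (hf : ContMDiff 𝓘(ℝ, E) 𝓘(ℝ, E') ∞ f) (p : M) :
    ∀ᶠ x in 𝓝 (extChartAt 𝓘(ℝ, E) p p), ∀ Z : Π q : M, TangentSpace 𝓘(ℝ, E) q,
      DifferentiableAt ℝ ((fun q => toChart p q (Z q)) ∘ (extChartAt 𝓘(ℝ, E) p).symm) x → ∀ u,
      toChart (f p) (f ((extChartAt 𝓘(ℝ, E) p).symm x))
        (derivAlong cov f (pushAlong f Z) ((extChartAt 𝓘(ℝ, E) p).symm x) (ofChart p _ u))
      = chartDeriv (chartChristoffel cov (f p) ∘ chartMap f p) (chartMap f p)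
          (fun x' => fderiv ℝ (chartMap f p) x'
            (toChart p ((extChartAt 𝓘(ℝ, E) p).symm x') (Z ((extChartAt 𝓘(ℝ, E) p).symm x'))))
          u x := by
  have hC2 := ((contDiffAt_chartMap hf p).of_le (m := 2) ENat.LEInfty.out).eventually
    (by simp)
  -- The chart conditions are needed on a neighbourhood of each nearby x, since the derivative at x
  -- depends on the germ there.
  filter_upwards [(eventually_mem_extChartAt_target p).and
    (eventually_mem_chart_source hf p) |>.eventually_nhds, hC2] with x hx hCx Z hZ u
  have hx1 := hx.self_of_nhds.1
  have hx2 := hx.self_of_nhds.2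
  have e : (fun q => toChart (f p) (f q) (pushAlong f Z q)) ∘ (extChartAt 𝓘(ℝ, E) p).symm
      =ᶠ[𝓝 x] fun x' => fderiv ℝ (chartMap f p) x'
        (toChart p ((extChartAt 𝓘(ℝ, E) p).symm x') (Z ((extChartAt 𝓘(ℝ, E) p).symm x'))) :=
    hx.mono fun x' h' => fderiv_chartMap_toChart hf h'.1 h'.2 _
  have hd : DifferentiableAt ℝ
      ((fun q => toChart (f p) (f q) (pushAlong f Z q)) ∘ (extChartAt 𝓘(ℝ, E) p).symm) x :=
    DifferentiableAt.congr_of_eventuallyEq ((hCx.differentiableAt_fderiv le_rfl).clm_apply hZ) e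
  have hm := (differentiableAt_comp_extChartAt_symm_iff hx1).1 hd
  rw [toChart_derivAlong cov hx2 (hf.mdifferentiable (by simp) _) hm,
    ← fderiv_comp_extChartAt_symm hx1 hm, e.fderiv_eq, chartDeriv]
  congr 1
  rw [← fderiv_chartMap hf hx1 hx2, pushAlong, fderiv_chartMap_toChart hf hx1 hx2]
  congr 2
  simp only [chartChristoffel, chartMap, Function.comp_apply]
  rw [(extChartAt 𝓘(ℝ, E') (f p)).left_inv (by simpa using hx2)]

omit [FiniteDimensional ℝ E] [IsManifold 𝓘(ℝ, E) ∞ M] in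
lemma eventually_chartMetric (hf : ContMDiff 𝓘(ℝ, E) 𝓘(ℝ, E') ∞ f) (p : M)
    (g : Bundle.ContMDiffRiemannianMetric 𝓘(ℝ, E') ∞ E' (TangentSpace 𝓘(ℝ, E') : N → Type _)) :
    ∀ᶠ x in 𝓝 (extChartAt 𝓘(ℝ, E) p p),
      ∀ v w : TangentSpace 𝓘(ℝ, E') (f ((extChartAt 𝓘(ℝ, E) p).symm x)),
      (chartMetric g (f p) ∘ chartMap f p) x (toChart (f p) _ v) (toChart (f p) _ w)
        = g.inner _ v w := by
  filter_upwards [eventually_mem_chart_source hf p] with x hx v w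
  rw [← metricCoeff_toChart g hx]
  simp only [chartMetric, chartMap, Function.comp_apply]
  rw [(extChartAt 𝓘(ℝ, E') (f p)).left_inv (by simpa using hx)]

variable (S : StatisticalStructure E' N)
  (cov cov' : CovariantDerivative 𝓘(ℝ, E') E' (TangentSpace 𝓘(ℝ, E') : N → Type _))

/-- The normal equations of the induced connection, in coordinates. -/
lemma eventually_inducedOp_normal (hf : IsSubmanifoldMap (E := E) (E' := E') f) (p : M) :
    ∀ᶠ x in 𝓝 (extChartAt 𝓘(ℝ, E) p p), ∀ Z : Π q : M, TangentSpace 𝓘(ℝ, E) q,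
      DifferentiableAt ℝ ((fun q => toChart p q (Z q)) ∘ (extChartAt 𝓘(ℝ, E) p).symm) x → ∀ u w,
      (chartMetric S.metric (f p) ∘ chartMap f p) x
        (chartDeriv (chartChristoffel cov (f p) ∘ chartMap f p) (chartMap f p)
          (fun x' => fderiv ℝ (chartMap f p) x'
            (toChart p ((extChartAt 𝓘(ℝ, E) p).symm x') (Z ((extChartAt 𝓘(ℝ, E) p).symm x'))))
          u x
          - fderiv ℝ (chartMap f p) x (toChart p _ (inducedOp S cov f Z
              ((extChartAt 𝓘(ℝ, E) p).symm x) (ofChart p _ u))))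
        (fderiv ℝ (chartMap f p) x w) = 0 := by
  filter_upwards [eventually_toChart_derivAlong_pushAlong cov hf.smooth p,
    eventually_chartMetric hf.smooth p S.metric, eventually_mem_extChartAt_target p,
    eventually_mem_chart_source hf.smooth p] with x h1 h2 hx hy Z hZ u w
  rw [← h1 Z hZ u, ← fderiv_chartMap_toChart hf.smooth hx hy, ← map_sub,
    fderiv_chartMap hf.smooth hx hy, h2]
  exact tangentialPart_spec S hf _ _ _

omit [FiniteDimensional ℝ E] [IsManifold 𝓘(ℝ, E) ∞ M] [FiniteDimensional ℝ E'] in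
lemma derivAlong_zero (s : Π q : M, TangentSpace 𝓘(ℝ, E') (f q)) (p : M) :
    derivAlong (E := E) cov f s p 0 = 0 := by
  rw [derivAlong, map_zero, map_zero, map_zero, trivializationAt_symm (mem_chart_source E' (f p)),
    map_zero, add_zero]

/-- The vanishing bracket enters the curvature as a direction, and `inducedOp` is not bundled as a
linear map. -/
lemma inducedOp_zero (hf : IsSubmanifoldMap (E := E) (E' := E') f)
    (Z : Π q : M, TangentSpace 𝓘(ℝ, E) q) (p : M) : inducedOp S cov f Z p 0 = 0 := by
  rw [inducedOp, derivAlong_zero]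
  refine (existsUnique_tangentialPart S hf p 0).unique (tangentialPart_spec S hf p 0) fun w => ?_
  simp

omit [FiniteDimensional ℝ E] in
lemma inducedMetric_eq (hf : ContMDiff 𝓘(ℝ, E) 𝓘(ℝ, E') ∞ f) (p : M)
    (v w : TangentSpace 𝓘(ℝ, E) p) :
    inducedMetric S f p v w = (chartMetric S.metric (f p) ∘ chartMap f p) (extChartAt 𝓘(ℝ, E) p p)
      (fderiv ℝ (chartMap f p) (extChartAt 𝓘(ℝ, E) p p) (toChart p p v))
      (fderiv ℝ (chartMap f p) (extChartAt 𝓘(ℝ, E) p p) (toChart p p w)) := by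
  have h := (eventually_chartMetric hf p S.metric).self_of_nhds
  rw [extChartAt_to_inv p] at h
  rw [← fderiv_chartMap_self hf, ← fderiv_chartMap_self hf, h, inducedMetric]

omit [FiniteDimensional ℝ E] in
lemma eventuallyEq_const_extend (p : M) (w : TangentSpace 𝓘(ℝ, E) p) :
    (fun x' => toChart p ((extChartAt 𝓘(ℝ, E) p).symm x')
      (FiberBundle.extend E w ((extChartAt 𝓘(ℝ, E) p).symm x')))
      =ᶠ[𝓝 (extChartAt 𝓘(ℝ, E) p p)] fun _ => toChart p p w := by
  filter_upwards [eventually_mem_extChartAt_target p] with x hx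
  exact toChart_extend w (extChartAt_symm_mem_source hx)

omit [FiniteDimensional ℝ E] in
lemma toChart_secondForm (hf : IsSubmanifoldMap (E := E) (E' := E') f) (p : M)
    (v w : TangentSpace 𝓘(ℝ, E) p) :
    toChart (f p) (f p) (secondForm S cov f p v w)
      = chartDeriv (chartChristoffel cov (f p) ∘ chartMap f p) (chartMap f p)
          (fun x' => fderiv ℝ (chartMap f p) x' (toChart p p w)) (toChart p p v)
          (extChartAt 𝓘(ℝ, E) p p)
        - fderiv ℝ (chartMap f p) (extChartAt 𝓘(ℝ, E) p p)
          (toChart p p (inducedOp S cov f (FiberBundle.extend E w) p v)) := by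
  have e := eventuallyEq_const_extend p w
  have h := (eventually_toChart_derivAlong_pushAlong cov hf.smooth p).self_of_nhds
    (FiberBundle.extend E w) ((differentiableAt_const _).congr_of_eventuallyEq e) (toChart p p v)
  rw [extChartAt_to_inv p, ofChart_toChart (mem_chart_source E p)] at h
  rw [secondForm, map_sub, h, fderiv_chartMap_self hf.smooth]
  congr 1
  exact chartDeriv_congr (e.mono fun x hx => by simp only [hx]) _

variable {S cov cov'}

set_option maxHeartbeats 1600000 in
/-- The Gauss equation of a submanifold, for a pair of dual connections. -/
theorem gauss_equation (hf : IsSubmanifoldMap (E := E) (E' := E') f)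
    (hcov : ∀ U : Set N, IsOpen U → ContMDiffCovariantDerivativeOn E' ∞ cov.toFun U)
    (hdual : IsDualPair cov cov' S.metric) (p : M) (X Y Z W : TangentSpace 𝓘(ℝ, E) p) :
    inducedMetric S f p (curvature (inducedOp S cov f) p X Y Z) W
      = S.metric.inner (f p) (curvature cov.op (f p) (mfderiv 𝓘(ℝ, E) 𝓘(ℝ, E') f p X)
          (mfderiv 𝓘(ℝ, E) 𝓘(ℝ, E') f p Y) (mfderiv 𝓘(ℝ, E) 𝓘(ℝ, E') f p Z))
          (mfderiv 𝓘(ℝ, E) 𝓘(ℝ, E') f p W)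
        + S.metric.inner (f p) (secondForm S cov f p Y Z) (secondForm S cov' f p X W)
        - S.metric.inner (f p) (secondForm S cov f p X Z) (secondForm S cov' f p Y W) := by
  set x₀ := extChartAt 𝓘(ℝ, E) p p with hx₀
  set F := chartMap (E := E) (E' := E') f p with hFdef
  set Γ := chartChristoffel cov (f p) with hΓdef
  set G := chartMetric S.metric (f p) with hGdef
  have hFx : F x₀ = extChartAt 𝓘(ℝ, E') (f p) (f p) := chartMap_self p
  have hFs : ContDiffAt ℝ ∞ F x₀ := contDiffAt_chartMap hf.smooth p
  have hF3 : ContDiffAt ℝ 3 F x₀ := hFs.of_le ENat.LEInfty.out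
  have hF2 : ContDiffAt ℝ 2 F x₀ := hFs.of_le ENat.LEInfty.out
  have hF1 : DifferentiableAt ℝ F x₀ := hFs.differentiableAt (by simp)
  have hΓ : DifferentiableAt ℝ Γ (F x₀) := by
    rw [hFx]; exact differentiableAt_chartChristoffel hcov (f p)
  have hΓF : DifferentiableAt ℝ (Γ ∘ F) x₀ :=
    DifferentiableAt.comp (G := E' →L[ℝ] E' →L[ℝ] E') (g := Γ) x₀ hΓ hF1
  have hG : ContDiffAt ℝ ∞ G (F x₀) := by rw [hFx]; exact contDiffAt_chartMetric S.metric (f p)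
  have hGF : ContDiffAt ℝ 2 (G ∘ F) x₀ := (hG.comp x₀ hFs).of_le ENat.LEInfty.out
  have hGx : (G ∘ F) x₀ = metricCoeff S.metric (f p) (f p) := by
    rw [Function.comp_apply, hFx, hGdef, chartMetric, Function.comp_apply, extChartAt_to_inv]
  have hy := mem_chart_source E' (f p)
  have hpos (a : E') (ha : a ≠ 0) : 0 < (G ∘ F) x₀ a a := by
    rw [hGx, metricCoeff_apply]
    refine S.metric.pos _ _ fun h0 => ha ?_
    rw [← toChart_ofChart hy a, h0, map_zero]
  have hinj : Function.Injective (fderiv ℝ F x₀) := by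
    rw [injective_iff_map_eq_zero]
    intro v hv
    have h1 := fderiv_chartMap_self hf.smooth p (ofChart p p v)
    rw [toChart_ofChart (mem_chart_source E p)] at h1
    have h2 := h1.trans hv
    have h3 : mfderiv 𝓘(ℝ, E) 𝓘(ℝ, E') f p (ofChart p p v) = 0 := by
      rw [← ofChart_toChart hy (mfderiv 𝓘(ℝ, E) 𝓘(ℝ, E') f p (ofChart p p v)), h2, map_zero]
    have h4 : ofChart p p v = 0 := hf.injective_mfderiv p (h3.trans (map_zero _).symm)
    rw [← toChart_ofChart (mem_chart_source E p) v, h4, map_zero]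
  -- Duality on the ambient manifold, pulled back along F by the chain rule.
  have hc : ∀ᶠ y in 𝓝 x₀, ∀ u a b, fderiv ℝ (G ∘ F) y u a b
      = (G ∘ F) y ((Γ ∘ F) y a (fderiv ℝ F y u)) b
        + (G ∘ F) y a ((chartChristoffel cov' (f p) ∘ F) y b (fderiv ℝ F y u)) := by
    have h1 := fderiv_chartMetric hdual (f p)
    rw [← hFx] at h1
    have h2 := (hG.of_le (m := 1) ENat.LEInfty.out).eventually (by simp)
    have hFc : Tendsto F (𝓝 x₀) (𝓝 (F x₀)) := hF1.continuousAt
    filter_upwards [hFc.eventually h1, hFc.eventually h2,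
      (hFs.of_le (m := 1) ENat.LEInfty.out).eventually (by simp)] with y h1 h2 h3 u a b
    rw [fderiv_comp y (h2.differentiableAt (by simp)) (h3.differentiableAt (by simp))]
    exact h1 _ _ _
  -- The neighbourhood does not depend on the field, and differentiability is asked only at the
  -- point considered. Hence this serves for the extended field near x₀ and also, at x₀ alone, for
  -- the field already differentiated once.
  have hnorm := eventually_inducedOp_normal S cov hf p
  have eZ := eventuallyEq_const_extend p Z
  have key (v : TangentSpace 𝓘(ℝ, E) p) : ∀ᶠ y in 𝓝 x₀, ∀ z, (G ∘ F) y
      (chartDeriv (Γ ∘ F) F (fun y' => fderiv ℝ F y' (toChart p p Z)) (toChart p p v) y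
        - fderiv ℝ F y (((fun q => toChart p q (inducedOp S cov f (FiberBundle.extend E Z) q
          (FiberBundle.extend E v q))) ∘ (extChartAt 𝓘(ℝ, E) p).symm) y)) (fderiv ℝ F y z) = 0 := by
    filter_upwards [hnorm, eZ.eventually_nhds, eventually_mem_extChartAt_target p]
      with y h1 h2 hy z
    have h3 := h1 (FiberBundle.extend E Z)
      ((differentiableAt_const (toChart p p Z)).congr_of_eventuallyEq h2) (toChart p p v) z
    rw [← extend_eq_ofChart v (extChartAt_symm_mem_source hy)] at h3
    have h4 := chartDeriv_congr (Γ := Γ ∘ F) (F := F) (s := fun x' => fderiv ℝ F x'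
      (toChart p ((extChartAt 𝓘(ℝ, E) p).symm x')
        (FiberBundle.extend E Z ((extChartAt 𝓘(ℝ, E) p).symm x'))))
      (s' := fun x' => fderiv ℝ F x' (toChart p p Z))
      (h2.mono fun x hx => congrArg (fderiv ℝ F x) hx) (toChart p p v)
    rw [← h4]
    exact h3
  -- Tangential parts are chosen point by point, so regularity of the induced derivative has to be
  -- recovered from the normal equations.
  have keyd (v : TangentSpace 𝓘(ℝ, E) p) : DifferentiableAt ℝ
      ((fun q => toChart p q (inducedOp S cov f (FiberBundle.extend E Z) q
          (FiberBundle.extend E v q))) ∘ (extChartAt 𝓘(ℝ, E) p).symm) x₀ := by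
    refine differentiableAt_of_normal_equations hF2 (hGF.differentiableAt (by simp)) hpos hinj
      (differentiableAt_chartDeriv hΓF hF2 ?_ _) (key v)
    exact (hF3.fderiv_right (m := 2) (by norm_num)).clm_apply contDiffAt_const
  have key2 (u v : TangentSpace 𝓘(ℝ, E) p) (z : E) : (G ∘ F) x₀
      (chartDeriv (Γ ∘ F) F (fun y' => fderiv ℝ F y' (((fun q => toChart p q
        (inducedOp S cov f (FiberBundle.extend E Z) q (FiberBundle.extend E v q)))
          ∘ (extChartAt 𝓘(ℝ, E) p).symm) y')) (toChart p p u) x₀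
        - fderiv ℝ F x₀ (toChart p p (inducedOp S cov f (fun q => inducedOp S cov f
          (FiberBundle.extend E Z) q (FiberBundle.extend E v q)) p u))) (fderiv ℝ F x₀ z) = 0 := by
    have := hnorm.self_of_nhds _ (keyd v) (toChart p p u) z
    rw [extChartAt_to_inv p, ofChart_toChart (mem_chart_source E p)] at this
    exact this
  -- The free tangent vectors are taken to be the tangential parts for `cov'`, so that the second
  -- factors become its second fundamental form.
  have main := chart_gauss (d := toChart p p W)
    (Yu := toChart p p (inducedOp S cov' f (FiberBundle.extend E W) p X))
    (Yv := toChart p p (inducedOp S cov' f (FiberBundle.extend E W) p Y))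
    hΓF hF3 hGF hpos hinj hc (key X) (key Y) (key2 X Y) (key2 Y X)
  rw [inducedMetric_eq S hf.smooth, curvature, curvatureField, mlieBracket_extend,
    inducedOp_zero S cov hf, sub_zero, map_sub, FiberBundle.extend_apply_self,
    FiberBundle.extend_apply_self]
  refine main.trans ?_
  rw [chartCurv_comp hΓ hF1, hFx, ← fderiv_chartMap_self hf.smooth, ← fderiv_chartMap_self hf.smooth,
    ← fderiv_chartMap_self hf.smooth, ← fderiv_chartMap_self hf.smooth,
    ← toChart_curvature cov (by rwa [← hFx]), hGx, metricCoeff_toChart S.metric hy]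
  have e1 (v : TangentSpace 𝓘(ℝ, E) p) : ((fun q => toChart p q (inducedOp S cov f
      (FiberBundle.extend E Z) q (FiberBundle.extend E v q))) ∘ (extChartAt 𝓘(ℝ, E) p).symm) x₀
      = toChart p p (inducedOp S cov f (FiberBundle.extend E Z) p v) := by
    rw [Function.comp_apply, extChartAt_to_inv p, FiberBundle.extend_apply_self]
  rw [e1, e1, ← toChart_secondForm S cov hf, ← toChart_secondForm S cov' hf,
    ← toChart_secondForm S cov hf, ← toChart_secondForm S cov' hf,
    metricCoeff_toChart S.metric hy, metricCoeff_toChart S.metric hy]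

/-- The curvature tensors of dual connections. -/
theorem inner_curvature_dual
    (hcov : ∀ U : Set N, IsOpen U → ContMDiffCovariantDerivativeOn E' ∞ cov.toFun U)
    (hcov' : ∀ U : Set N, IsOpen U → ContMDiffCovariantDerivativeOn E' ∞ cov'.toFun U)
    (hdual : IsDualPair cov cov' S.metric) (y : N) (u v w t : TangentSpace 𝓘(ℝ, E') y) :
    S.metric.inner y (curvature cov.op y u v w) t
      + S.metric.inner y w (curvature cov'.op y u v t) = 0 := by
  have hy := mem_chart_source E' y
  have hΓ := differentiableAt_chartChristoffel hcov y
  have hΓ' := differentiableAt_chartChristoffel hcov' y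
  -- The case of the identity map, where the pull-back connection is the connection itself.
  have h := chartCurv_dual hΓ hΓ' contDiffAt_id
    ((contDiffAt_chartMetric S.metric y).of_le (m := 2) ENat.LEInfty.out)
    (by simpa [fderiv_id] using fderiv_chartMetric hdual y)
    (toChart y y u) (toChart y y v) (toChart y y w) (toChart y y t)
  rw [← toChart_curvature cov hΓ, ← toChart_curvature cov' hΓ', chartMetric, Function.comp_apply,
    extChartAt_to_inv y, metricCoeff_toChart S.metric hy, metricCoeff_toChart S.metric hy] at h
  exact h

omit [FiniteDimensional ℝ E] in
/-- The second fundamental form of a torsion-free connection is symmetric. -/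
theorem secondForm_symm (hf : IsSubmanifoldMap (E := E) (E' := E') f) (htor : cov.torsion = 0)
    (p : M) (v w : TangentSpace 𝓘(ℝ, E) p) :
    secondForm S cov f p v w = secondForm S cov f p w v := by
  have hF2 : ContDiffAt ℝ 2 (chartMap (E := E) (E' := E') f p) (extChartAt 𝓘(ℝ, E) p p) :=
    (contDiffAt_chartMap hf.smooth p).of_le ENat.LEInfty.out
  have hF1 := hF2.differentiableAt_fderiv le_rfl
  have hΓ : (chartChristoffel cov (f p) ∘ chartMap f p) (extChartAt 𝓘(ℝ, E) p p)
      = christoffel cov (f p) (f p) := by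
    rw [Function.comp_apply, chartMap_self, chartChristoffel, Function.comp_apply,
      extChartAt_to_inv]
  -- In coordinates ∇_v(dF w) = D²F(v, w) + Γ(dF w, dF v), and both terms are symmetric in v, w when
  -- the torsion vanishes.
  have hd (v w : TangentSpace 𝓘(ℝ, E) p) :
      toChart (f p) (f p) (derivAlong cov f (pushAlong f (FiberBundle.extend E w)) p v)
        = fderiv ℝ (fderiv ℝ (chartMap f p)) (extChartAt 𝓘(ℝ, E) p p) (toChart p p v)
            (toChart p p w)
          + christoffel cov (f p) (f p)
            (fderiv ℝ (chartMap f p) (extChartAt 𝓘(ℝ, E) p p) (toChart p p w))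
            (fderiv ℝ (chartMap f p) (extChartAt 𝓘(ℝ, E) p p) (toChart p p v)) := by
    have h := toChart_secondForm S cov hf p v w
    rw [secondForm, map_sub, fderiv_chartMap_self hf.smooth, sub_left_inj] at h
    rw [h, chartDeriv, hΓ, (hF1.hasFDerivAt.clm_apply (hasFDerivAt_const _ _)).fderiv]
    simp
  have hsymm : derivAlong cov f (pushAlong f (FiberBundle.extend E w)) p v
      = derivAlong cov f (pushAlong f (FiberBundle.extend E v)) p w := by
    rw [← ofChart_toChart (mem_chart_source E' (f p))
      (derivAlong cov f (pushAlong f (FiberBundle.extend E w)) p v), hd,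
      hF2.fderiv_fderiv_comm le_rfl, christoffel_symm htor, ← hd,
      ofChart_toChart (mem_chart_source E' (f p))]
  -- The tangential part depends only on the derivative along `f`, so it is symmetric as well.
  rw [secondForm, secondForm, inducedOp, inducedOp, hsymm]

end Gauss

/-! ### The Levi-Civita connection as a mean, and the formula for K - K∘. -/

section MeanConnection

variable {E : Type*} [NormedAddCommGroup E] [NormedSpace ℝ E] [FiniteDimensional ℝ E]
  {M : Type*} [TopologicalSpace M] [ChartedSpace E M] [IsManifold 𝓘(ℝ, E) ∞ M]
  {E' : Type*} [NormedAddCommGroup E'] [NormedSpace ℝ E'] [FiniteDimensional ℝ E']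
  {N : Type*} [TopologicalSpace N] [ChartedSpace E' N] [IsManifold 𝓘(ℝ, E') ∞ N]

/-- The Levi-Civita connection `(∇ + ∇*)/2` of a statistical manifold. -/
def StatisticalStructure.mean (S : StatisticalStructure E' N) :
    CovariantDerivative 𝓘(ℝ, E') E' (TangentSpace 𝓘(ℝ, E') : N → Type _) :=
  CovariantDerivative.affineCombination S.conn S.dual fun _ => 1 / 2

variable (S : StatisticalStructure E' N)

lemma StatisticalStructure.mean_apply (Z : Π x : N, TangentSpace 𝓘(ℝ, E') x) (x : N)
    (v : TangentSpace 𝓘(ℝ, E') x) :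
    S.mean Z x v = (1 / 2 : ℝ) • (S.conn Z x v + S.dual Z x v) := by
  change (1 / 2 : ℝ) • S.conn Z x v + (1 - 1 / 2 : ℝ) • S.dual Z x v = _
  rw [smul_add]
  norm_num

/-- `sectionalAmbientLC` uses the bare operation `meanOp`, while the Gauss equation needs a bundled
connection. -/
lemma StatisticalStructure.mean_op : S.mean.op = meanOp S.conn.op S.dual.op := by
  ext Z x v
  exact S.mean_apply Z x v

lemma StatisticalStructure.mean_smooth (U : Set N) (hU : IsOpen U) :
    ContMDiffCovariantDerivativeOn E' ∞ S.mean.toFun U :=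
  ContMDiffCovariantDerivativeOn.affine_combination contMDiffOn_const (S.conn_smooth U hU)
    (S.dual_smooth U hU)

lemma StatisticalStructure.isDualPair : IsDualPair S.conn S.dual S.metric := S.compat

lemma StatisticalStructure.isDualPair_symm : IsDualPair S.dual S.conn S.metric := by
  intro x X Y Z hY hZ
  have h := S.compat x X Z Y hZ hY
  simp_rw [fun y => S.metric.symm y (Z y) (Y y)] at h
  rw [h, S.metric.symm x (S.dual Y x (X x)), S.metric.symm x (Y x), add_comm]

/-- Averaging the duality identities of (∇, ∇*) and (∇*, ∇) shows that the mean is metric, so the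
Gauss equation for dual pairs applies to it. -/
lemma StatisticalStructure.isDualPair_mean : IsDualPair S.mean S.mean S.metric := by
  intro x X Y Z hY hZ
  have h := S.isDualPair x X Y Z hY hZ
  have h' := S.isDualPair_symm x X Y Z hY hZ
  rw [S.mean_apply, S.mean_apply]
  simp only [map_smul, map_add, add_apply, smul_apply, smul_eq_mul]
  linarith

omit [FiniteDimensional ℝ E] [IsManifold 𝓘(ℝ, E) ∞ M] in
lemma derivAlong_mean (f : M → N) (s : Π q : M, TangentSpace 𝓘(ℝ, E') (f q)) (p : M)
    (v : TangentSpace 𝓘(ℝ, E) p) : derivAlong S.mean f s p v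
      = (1 / 2 : ℝ) • (derivAlong S.conn f s p v + derivAlong S.dual f s p v) := by
  rw [derivAlong, derivAlong, derivAlong, S.mean_apply]
  module

variable {S} {f : M → N}

/-- Tangential parts are unique, hence additive and homogeneous, so inducing commutes with taking
the mean. -/
lemma inducedOp_mean (hf : IsSubmanifoldMap (E := E) (E' := E') f) :
    inducedOp (E := E) S S.mean f = meanOp (inducedOp S S.conn f) (inducedOp S S.dual f) := by
  ext Z p v
  refine (existsUnique_tangentialPart S hf p _).unique (tangentialPart_spec S hf p _) fun w => ?_
  have h := tangentialPart_spec S hf p (derivAlong S.conn f (pushAlong f Z) p v) w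
  have h' := tangentialPart_spec S hf p (derivAlong S.dual f (pushAlong f Z) p v) w
  rw [derivAlong_mean, meanOp, inducedOp, inducedOp]
  simp only [map_smul, map_add, map_sub, add_apply, sub_apply, smul_apply, smul_eq_mul] at h h' ⊢
  linarith

lemma secondForm_mean (hf : IsSubmanifoldMap (E := E) (E' := E') f) (p : M)
    (v w : TangentSpace 𝓘(ℝ, E) p) : secondForm S S.mean f p v w
      = (1 / 2 : ℝ) • (secondForm S S.conn f p v w + secondForm S S.dual f p v w) := by
  rw [secondForm, secondForm, secondForm, derivAlong_mean, inducedOp_mean hf, meanOp, map_smul,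
    map_add]
  module

/-- The difference of the sectional `K`-curvature and the Riemannian sectional curvature of a
submanifold, in terms of the second fundamental forms. -/
theorem sectionalK_sub_sectionalLC (hf : IsSubmanifoldMap (E := E) (E' := E') f) (p : M)
    (X Y : TangentSpace 𝓘(ℝ, E) p) :
    sectionalK S f p X Y - sectionalLC S f p X Y
      = 1 / 2 * (S.metric.inner (f p) (curvature S.conn.op (f p)
            (mfderiv 𝓘(ℝ, E) 𝓘(ℝ, E') f p X) (mfderiv 𝓘(ℝ, E) 𝓘(ℝ, E') f p Y)
            (mfderiv 𝓘(ℝ, E) 𝓘(ℝ, E') f p Y)) (mfderiv 𝓘(ℝ, E) 𝓘(ℝ, E') f p X)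
          - S.metric.inner (f p) (curvature S.conn.op (f p)
            (mfderiv 𝓘(ℝ, E) 𝓘(ℝ, E') f p X) (mfderiv 𝓘(ℝ, E) 𝓘(ℝ, E') f p Y)
            (mfderiv 𝓘(ℝ, E) 𝓘(ℝ, E') f p X)) (mfderiv 𝓘(ℝ, E) 𝓘(ℝ, E') f p Y))
        - 2 * sectionalAmbientLC S f p X Y
        - 1 / 2 * (S.metric.inner (f p) (secondForm S S.conn f p X X) (secondForm S S.conn f p Y Y)
          + S.metric.inner (f p) (secondForm S S.dual f p X X) (secondForm S S.dual f p Y Y))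
        + 1 / 2 * (S.metric.inner (f p) (secondForm S S.conn f p X Y) (secondForm S S.conn f p X Y)
          + S.metric.inner (f p) (secondForm S S.dual f p X Y)
            (secondForm S S.dual f p X Y)) := by
  -- With weights ½, ½, -2 for the three Gauss equations, the products of σ with σ* cancel, because
  -- (σ+σ*)/2 enters the third one quadratically.
  have h1 := gauss_equation hf S.conn_smooth S.isDualPair p X Y Y X
  have h2 := gauss_equation hf S.dual_smooth S.isDualPair_symm p X Y Y X
  have h3 := gauss_equation hf S.mean_smooth S.isDualPair_mean p X Y Y X
  -- Trades ĝ(R̂*(X,Y)Y, X) for -ĝ(R̂(X,Y)X, Y), so that only the curvature of ∇̂, which is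
  -- prescribed, remains.
  have h4 := inner_curvature_dual S.conn_smooth S.dual_smooth S.isDualPair (f p)
    (mfderiv 𝓘(ℝ, E) 𝓘(ℝ, E') f p X) (mfderiv 𝓘(ℝ, E) 𝓘(ℝ, E') f p Y)
    (mfderiv 𝓘(ℝ, E) 𝓘(ℝ, E') f p X) (mfderiv 𝓘(ℝ, E) 𝓘(ℝ, E') f p Y)
  rw [S.metric.symm _ (mfderiv 𝓘(ℝ, E) 𝓘(ℝ, E') f p X) (curvature S.dual.op _ _ _ _)] at h4
  rw [secondForm_symm hf S.conn_torsion p Y X] at h2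
  rw [secondForm_symm hf S.dual_torsion p Y X] at h1
  rw [inducedOp_mean hf, S.mean_op, secondForm_mean hf, secondForm_mean hf, secondForm_mean hf,
    secondForm_mean hf, secondForm_symm hf S.conn_torsion p Y X,
    secondForm_symm hf S.dual_torsion p Y X] at h3
  rw [sectionalK, sectionalLC, sectionalAmbientLC, h1, h2, h3]
  simp only [map_smul, map_add, add_apply, smul_apply, smul_eq_mul]
  rw [S.metric.symm _ (secondForm S S.dual f p X Y) (secondForm S S.conn f p X Y),
    S.metric.symm _ (secondForm S S.dual f p Y Y) (secondForm S S.conn f p X X),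
    S.metric.symm _ (secondForm S S.conn f p Y Y) (secondForm S S.conn f p X X),
    S.metric.symm _ (secondForm S S.dual f p Y Y) (secondForm S S.dual f p X X),
    S.metric.symm _ (secondForm S S.conn f p Y Y) (secondForm S S.dual f p X X)]
  linarith

omit [FiniteDimensional ℝ E] [IsManifold 𝓘(ℝ, E) ∞ M] in
/-- The ambient curvature tensor on the tangent spaces of a totally real submanifold. -/
lemma inner_curvature_of_isTotallyReal
    {Λ : Π x : N, Submodule ℝ (TangentSpace 𝓘(ℝ, E') x →L[ℝ] TangentSpace 𝓘(ℝ, E') x)} {c : ℝ}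
    (hS : IsQuaternionicKaehlerLike S Λ c) (hreal : IsTotallyReal (E := E) S Λ f) (p : M)
    (X Y Z W : TangentSpace 𝓘(ℝ, E) p) :
    S.metric.inner (f p) (curvature S.conn.op (f p) (mfderiv 𝓘(ℝ, E) 𝓘(ℝ, E') f p X)
        (mfderiv 𝓘(ℝ, E) 𝓘(ℝ, E') f p Y) (mfderiv 𝓘(ℝ, E) 𝓘(ℝ, E') f p Z))
        (mfderiv 𝓘(ℝ, E) 𝓘(ℝ, E') f p W)
      = c / 4 * (inducedMetric S f p Y Z * inducedMetric S f p X W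
        - inducedMetric S f p X Z * inducedMetric S f p Y W) := by
  obtain ⟨U, J, hx, hJ⟩ := hS.almostQuaternionic (f p)
  have hz (α) (v w : TangentSpace 𝓘(ℝ, E) p) : S.metric.inner (f p)
      (J α (f p) (mfderiv 𝓘(ℝ, E) 𝓘(ℝ, E') f p v)) (mfderiv 𝓘(ℝ, E) 𝓘(ℝ, E') f p w) = 0 := by
    refine hreal p _ ?_ v w
    rw [hJ.span_eq _ hx]
    exact Submodule.subset_span ⟨α, rfl⟩
  have hz' (α) (v w : TangentSpace 𝓘(ℝ, E) p) : S.metric.inner (f p)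
      (mfderiv 𝓘(ℝ, E) 𝓘(ℝ, E') f p w) (J α (f p) (mfderiv 𝓘(ℝ, E) 𝓘(ℝ, E') f p v)) = 0 := by
    rw [S.metric.symm, hz]
  rw [hS.curvature_eq U J hJ (f p) hx]
  -- Each J-term carries a coefficient pairing a tangent vector with the J-image of another, which
  -- is zero.
  simp only [hz, hz', zero_smul, sub_zero, Finset.sum_const_zero, add_zero, map_smul, map_sub,
    smul_apply, sub_apply, smul_eq_mul, inducedMetric]

end MeanConnection

/-! ### Sums over pairs of frame vectors. -/

section ScalarCurvature

variable {V : Type*} {n : ℕ} {e : Fin n → V} {i j : Fin n}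

/-- The full double sum splits into the parts i < j, j < i and the diagonal; by symmetry the first
two are equal. -/
lemma two_mul_scalarOf_add_sum {k : V → V → ℝ} (hk : ∀ v w, k v w = k w v) (e : Fin n → V) :
    2 * scalarOf k e + ∑ i, k (e i) (e i) = ∑ i, ∑ j, k (e i) (e j) := by
  have h1 (i : Fin n) : ∑ j, k (e i) (e j)
      = ∑ j ∈ Finset.univ.filter (fun j => i < j), k (e i) (e j)
        + ∑ j ∈ Finset.univ.filter (fun j => j < i), k (e i) (e j) + k (e i) (e i) := by
    have h (j) : k (e i) (e j) = (if i < j then k (e i) (e j) else 0)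
        + (if j < i then k (e i) (e j) else 0) + if j = i then k (e i) (e j) else 0 := by
      rcases lt_trichotomy i j with h | h | h
      · simp [h, h.not_gt, h.ne']
      · simp [h]
      · simp [h, h.not_gt, h.ne]
    rw [Finset.sum_congr rfl fun j _ => h j]
    simp [Finset.sum_add_distrib, Finset.sum_filter]
  have h2 : ∑ i, ∑ j ∈ Finset.univ.filter (fun j => j < i), k (e i) (e j) = scalarOf k e := by
    rw [scalarOf, Finset.sum_comm' (t' := Finset.univ) (s' := fun j => Finset.univ.filter (j < ·))
      (by simp)]
    exact Finset.sum_congr rfl fun i _ => Finset.sum_congr rfl fun j _ => hk _ _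
  simp_rw [h1, Finset.sum_add_distrib]
  rw [h2, scalarOf]
  ring

lemma scalarOf_one (e : Fin n → V) : scalarOf (fun _ _ => 1) e = (n * (n - 1) : ℝ) / 2 := by
  have := two_mul_scalarOf_add_sum (k := fun _ _ : V => 1) (fun _ _ => rfl) e
  simp at this
  linarith

lemma le_scalarOf {k : V → V → ℝ} (hk : ∀ v w, k v w = k w v) (h0 : ∀ v w, 0 ≤ k v w)
    (hij : i ≠ j) : k (e i) (e j) ≤ scalarOf k e := by
  wlog h : i < j generalizing i j
  · rw [hk]
    exact this hij.symm (lt_of_le_of_ne (not_lt.1 h) hij.symm)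
  refine le_trans ?_ (Finset.single_le_sum
    (f := fun i => ∑ j ∈ Finset.univ.filter (fun j => i < j), k (e i) (e j))
    (fun i _ => Finset.sum_nonneg fun j _ => h0 _ _) (Finset.mem_univ i))
  exact Finset.single_le_sum (f := fun j => k (e i) (e j)) (fun j _ => h0 _ _) (by simpa using h)

/-- For a sum of vectors that vanishes, the sum of the products of all pairs but one is not
positive. -/
lemma scalarOf_le_of_sum_eq_zero {W : Type*} [AddCommGroup W] [Module ℝ W] [TopologicalSpace W]
    [IsTopologicalAddGroup W] [ContinuousConstSMul ℝ W]
    {B : W →L[ℝ] W →L[ℝ] ℝ} (hB : ∀ v w, B v w = B w v) (hB0 : ∀ v, 0 ≤ B v v) {a : V → W}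
    (ha : ∑ i, a (e i) = 0) (hij : i ≠ j) :
    scalarOf (fun v w => B (a v) (a w)) e ≤ B (a (e i)) (a (e j)) := by
  have h1 := two_mul_scalarOf_add_sum (k := fun v w => B (a v) (a w)) (fun v w => hB _ _) e
  simp_rw [← map_sum, ha, map_zero, Finset.sum_const_zero] at h1
  -- By `h1`, twice the sum over pairs equals -Σ |a_l|². Keep only the squares for i and j, then use
  -- |a_i + a_j|² ≥ 0.
  have h2 : ∑ l ∈ {i, j}, B (a (e l)) (a (e l)) ≤ ∑ l, B (a (e l)) (a (e l)) :=
    Finset.sum_le_sum_of_subset_of_nonneg (Finset.subset_univ _) fun l _ _ => hB0 _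
  rw [Finset.sum_pair hij] at h2
  have h3 := hB0 (a (e i) + a (e j))
  simp only [map_add, add_apply] at h3
  have h4 := hB (a (e i)) (a (e j))
  linarith

end ScalarCurvature

end

/-! ### The theorem. -/

theorem mainTheorem2 {m n : ℕ}
    {N : Type*} [TopologicalSpace N] [ChartedSpace (EuclideanSpace ℝ (Fin (4 * m))) N]
    [IsManifold (𝓡 (4 * m)) ∞ N]
    {M : Type*} [TopologicalSpace M] [ChartedSpace (EuclideanSpace ℝ (Fin n)) M]
    [IsManifold (𝓡 n) ∞ M]
    (S : StatisticalStructure (EuclideanSpace ℝ (Fin (4 * m))) N)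
    (Λ : Π x : N, Submodule ℝ (TangentSpace (𝓡 (4 * m)) x →L[ℝ] TangentSpace (𝓡 (4 * m)) x))
    (c : ℝ) (hS : IsQuaternionicKaehlerLike S Λ c)
    (f : M → N)
    (hf : IsSubmanifoldMap (E := EuclideanSpace ℝ (Fin n))
      (E' := EuclideanSpace ℝ (Fin (4 * m))) f)
    (hreal : IsTotallyReal (E := EuclideanSpace ℝ (Fin n)) S Λ f)
    (p : M) (e : Fin n → TangentSpace (𝓡 n) p) (he : IsOrthonormalFrame S f p e)
    (i j : Fin n) (hij : i ≠ j)
    (h : (scalarOf (sectionalK S f p) e - scalarOf (sectionalLC S f p) e)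
          - (sectionalK S f p (e i) (e j) - sectionalLC S f p (e i) (e j))
        < c / 8 * ((n : ℝ) - 2) * ((n : ℝ) + 1)
          + 2 * sectionalAmbientLC S f p (e i) (e j)
          - 2 * scalarOf (sectionalAmbientLC S f p) e) :
    ¬ IsMinimal (E := EuclideanSpace ℝ (Fin n)) S f := by
  intro hmin
  -- The index `i : Fin n` forces n ≠ 0; for n = 0 the factor 1/n would be 0 and could not be
  -- cancelled.
  have hn : (1 / n : ℝ) ≠ 0 := by
    have : NeZero n := ⟨fun h0 => (h0 ▸ i).elim0⟩
    simp [NeZero.ne n]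
  obtain ⟨H, H'⟩ := hmin p n e he
  have hB := S.metric.symm (f p)
  have hB0 (v) : 0 ≤ S.metric.inner (f p) v v := by
    by_cases hv : v = 0
    · simp [hv]
    · exact (S.metric.pos (f p) v hv).le
  have hs := (smul_eq_zero.1 H).resolve_left hn
  have hs' := (smul_eq_zero.1 H').resolve_left hn
  have hP := scalarOf_le_of_sum_eq_zero hB hB0 (a := fun v => secondForm S S.conn f p v v) hs hij
  have hP' := scalarOf_le_of_sum_eq_zero hB hB0 (a := fun v => secondForm S S.dual f p v v) hs' hij
  have hQ := le_scalarOf (e := e) (k := fun v w => S.metric.inner (f p)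
    (secondForm S S.conn f p v w) (secondForm S S.conn f p v w))
    (fun v w => by simp only [secondForm_symm hf S.conn_torsion p v w]) (fun v w => hB0 _) hij
  have hQ' := le_scalarOf (e := e) (k := fun v w => S.metric.inner (f p)
    (secondForm S S.dual f p v w) (secondForm S S.dual f p v w))
    (fun v w => by simp only [secondForm_symm hf S.dual_torsion p v w]) (fun v w => hB0 _) hij
  -- The factor 1 in `c / 4 * 1` lets the constant term sum to a multiple of `scalarOf (fun _ _ =>
  -- 1)`, the number of pairs.
  have hK (k l : Fin n) (hkl : k ≠ l) :
      sectionalK S f p (e k) (e l) - sectionalLC S f p (e k) (e l)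
      = c / 4 * 1 - 2 * sectionalAmbientLC S f p (e k) (e l)
        - 1 / 2 * (S.metric.inner (f p) (secondForm S S.conn f p (e k) (e k))
            (secondForm S S.conn f p (e l) (e l))
          + S.metric.inner (f p) (secondForm S S.dual f p (e k) (e k))
            (secondForm S S.dual f p (e l) (e l)))
        + 1 / 2 * (S.metric.inner (f p) (secondForm S S.conn f p (e k) (e l))
            (secondForm S S.conn f p (e k) (e l))
          + S.metric.inner (f p) (secondForm S S.dual f p (e k) (e l))
            (secondForm S S.dual f p (e k) (e l))) := by
    rw [sectionalK_sub_sectionalLC hf, inner_curvature_of_isTotallyReal hS hreal,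
      inner_curvature_of_isTotallyReal hS hreal, he.2, he.2, he.2, he.2]
    simp only [hkl, hkl.symm, if_true, if_false]
    ring
  have hsum : scalarOf (sectionalK S f p) e - scalarOf (sectionalLC S f p) e
      = c / 4 * scalarOf (fun _ _ => 1) e - 2 * scalarOf (sectionalAmbientLC S f p) e
        - 1 / 2 * (scalarOf (fun v w => S.metric.inner (f p) (secondForm S S.conn f p v v)
            (secondForm S S.conn f p w w)) e
          + scalarOf (fun v w => S.metric.inner (f p) (secondForm S S.dual f p v v)
            (secondForm S S.dual f p w w)) e)
        + 1 / 2 * (scalarOf (fun v w => S.metric.inner (f p) (secondForm S S.conn f p v w)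
            (secondForm S S.conn f p v w)) e
          + scalarOf (fun v w => S.metric.inner (f p) (secondForm S S.dual f p v w)
            (secondForm S S.dual f p v w)) e) := by
    simp only [scalarOf, Finset.mul_sum, ← Finset.sum_add_distrib, ← Finset.sum_sub_distrib]
    exact Finset.sum_congr rfl fun k _ => Finset.sum_congr rfl fun l hl =>
      hK k l (Finset.mem_filter.1 hl).2.ne
  rw [hsum, hK i j hij, scalarOf_one] at h
  -- The constants match because (c/4)(n(n-1)/2 - 1) = c/8 (n-2)(n+1); `hP`, `hP'`, `hQ` and `hQ'`
  -- give the signs of the remaining terms.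
  nlinarith
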